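/- Let $\mathcal A$ be a finite non-empty alphabet with $n$ letters. A pair on $\mathcal A$ is $\mathbf p=(p_0,p_1)$ with bijections $p_\varepsilon:\mathcal A\to\{1,\dots,n\}$, $\varepsilon\in\{0,1\}$. It is irreducible if, for $1\le k\le n$, $p_0^{-1}\{1,\dots,k\}=p_1^{-1}\{1,\dots,k\}$ only when $k=n$. Classes. On irreducible pairs, the Rauzy move of type $\varepsilon$ fixes $p_\varepsilon$ and replaces $p_{1-\varepsilon}$ by $p'_{1-\varepsilon}$, where, with $z=p_\varepsilon^{-1}(n)$, $p'_{1-\varepsilon}(b)=p_{1-\varepsilon}(b)$ if $p_{1-\varepsilon}(b)\le p_{1-\varepsilon}(z)$, $p'_{1-\varepsilon}(b)=p_{1-\varepsilon}(b)+1$ if $p_{1-\varepsilon}(z)<p_{1-\varepsilon}(b)<n$, and $p'_{1-\varepsilon}(b)=p_{1-\varepsilon}(z)+1$ otherwise. The left Rauzy move of type $\varepsilon$ fixes $p_\varepsilon$ and, with $a=p_\varepsilon^{-1}(1)$, sets $p'_{1-\varepsilon}(b)=p_{1-\varepsilon}(a)-1$ if $p_{1-\varepsilon}(b)=1$, $p'_{1-\varepsilon}(b)=p_{1-\varepsilon}(b)-1$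 if $1<p_{1-\varepsilon}(b)<p_{1-\varepsilon}(a)$, and $p'_{1-\varepsilon}(b)=p_{1-\varepsilon}(b)$ otherwise. The Extended Rauzy Class of $\mathbf p$ is its class for the smallest equivalence relation on irreducible pairs closed under both kinds of moves, of both types. The non-labeled Extended Rauzy Class of $\mathbf p$ is the image of this class under $(p_0,p_1)\mapsto p_1\circ p_0^{-1}\in\mathfrak S_n$. The list $P(\mathbf p)$. Define $S:\mathcal A\to\mathcal A$ by $S(\alpha)=p_0^{-1}(1)$ if $p_1(\alpha)=1$; $S(\alpha)=p_0^{-1}\big(p_0(p_1^{-1}(n))+1\big)$ if $p_1(\alpha)=p_1(p_0^{-1}(n))+1$; and $S(\alpha)=p_0^{-1}\big(p_0(p_1^{-1}(p_1(\alpha)-1))+1\big)$ otherwise. Let $Y$ be the first return map of $S$ to $\mathcal A\setminus\{p_0^{-1}(1)\}$. Then $P(\mathbf p)$ is the multiset of lengths of the cycles of $Y$. Types. A pair is standard if $p_0^{-1}(1)=p_1^{-1}(n)$ and $p_1^{-1}(1)=p_0^{-1}(n)$. A standard pair is piece-wise order reversing if there are $2=k_0<k_1<\dots<k_\ell=n$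 such that, for each $1\le i\le\ell$, both rows have the same set of letters in positions $k_{i-1},\dots,k_i-1$ (a block, of size $k_i-k_{i-1}$), and $p_0(b)+p_1(b)=k_{i-1}+k_i-1$ for each letter $b$ in it; a block of size $k$ is called a $k$-block. Its chains are the (possibly empty) runs of consecutive blocks that remain when the sequence of blocks is cut at each $1$-block. Such a pair is of - Type 1 if at most one chain is non-empty and such a chain consists of one block; - Type 2 if all non-empty chains consist of $2$-blocks; - Type 3 if each non-empty chain consists either of $m\ge0$ $2$-blocks, then a $3$-block, then $l\ge0$ $2$-blocks, or of $m>0$ $2$-blocks, and at least one chain is of the former form; - Type 4 if exactly one chain is a $4$-block followed by $m\ge0$ $2$-blocks and all other non-empty chains consist of $2$-blocks; - Type 5 if exactly one chain is a single $5$-block and every other non-empty chain is a single $2$-block; where Types 2–5 also require that more than one block has size at least $2$. An irreducible pair has Type $x$ if its Extended Rauzy Class contains a piece-wise order reversing pair of Type $x$ (for example, the pair itself). Theorem. Let $\mathbf p,\mathbf q$ be irreducible pairs on $\mathcal A$ that have a common Type $x\in\{1,\dots,5\}$. If $P(\mathbf p)=P(\mathbf q)$, then $\mathbf p$ and $\mathbf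 q$ have the same non-labeled Extended Rauzy Class. -/

import Mathlib

/-- A pair `p = (p₀, p₁)` on a finite alphabet `A` with `n` letters: two bijections from `A` onto
the `n` positions. Positions are stored as elements of `Fin n`; all definitions below use the
`1`-based position `RauzyPair.pos`, with values in `{1, …, n}`. -/
structure RauzyPair (A : Type*) [Fintype A] where
  row : Fin 2 → A ≃ Fin (Fintype.card A)

namespace RauzyPair

variable {A : Type*} [Fintype A]

/-- `p.pos ε b` is the number `p_ε(b) ∈ {1, …, #A}`. -/
def pos (p : RauzyPair A) (ε : Fin 2) (b : A) : ℕ := (p.row ε b : ℕ) + 1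

/-- `p.letter ε k` is the letter `p_ε⁻¹(k)`, for `1 ≤ k ≤ #A`
(for other `k` it is an irrelevant value). -/
def letter [Nonempty A] (p : RauzyPair A) (ε : Fin 2) (k : ℕ) : A :=
  (p.row ε).symm ⟨(k - 1) % Fintype.card A, Nat.mod_lt _ Fintype.card_pos⟩

theorem pos_letter [Nonempty A] (p : RauzyPair A) (ε : Fin 2) (k : ℕ)
    (h1 : 1 ≤ k) (hk : k ≤ Fintype.card A) : p.pos ε (p.letter ε k) = k := by
  simp only [pos, letter, Equiv.apply_symm_apply]
  rw [Nat.mod_eq_of_lt (by omega)]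
  omega

/-- Irreducibility: `p₀⁻¹{1,…,k} = p₁⁻¹{1,…,k}` holds for `k = #A` only. -/
def IsIrreducible (p : RauzyPair A) : Prop :=
  ∀ k : ℕ, 1 ≤ k → k ≤ Fintype.card A →
    ({b : A | p.pos 0 b ≤ k} = {b : A | p.pos 1 b ≤ k} ↔ k = Fintype.card A)

/-- `p' = ε p`: the (right) Rauzy move of type `ε`, where `z = p_ε⁻¹(#A)`. -/
def IsRauzyMove (ε : Fin 2) (p p' : RauzyPair A) : Prop :=
  p'.row ε = p.row ε ∧
  ∀ z : A, p.pos ε z = Fintype.card A → ∀ b : A,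
    p'.pos (1 - ε) b =
      if p.pos (1 - ε) b ≤ p.pos (1 - ε) z then p.pos (1 - ε) b
      else if p.pos (1 - ε) b < Fintype.card A then p.pos (1 - ε) b + 1
      else p.pos (1 - ε) z + 1

/-- `p' = ε̃ p`: the left Rauzy move of type `ε`, where `a = p_ε⁻¹(1)`. -/
def IsLeftRauzyMove (ε : Fin 2) (p p' : RauzyPair A) : Prop :=
  p'.row ε = p.row ε ∧
  ∀ a : A, p.pos ε a = 1 → ∀ b : A,
    p'.pos (1 - ε) b =
      if p.pos (1 - ε) b = 1 then p.pos (1 - ε) a - 1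
      else if p.pos (1 - ε) b < p.pos (1 - ε) a then p.pos (1 - ε) b - 1
      else p.pos (1 - ε) b

/-- One right or left Rauzy move, of either type, between irreducible pairs. -/
def ExtStep (p p' : RauzyPair A) : Prop :=
  p.IsIrreducible ∧ p'.IsIrreducible ∧ ∃ ε : Fin 2, IsRauzyMove ε p p' ∨ IsLeftRauzyMove ε p p'

/-- The (labeled) extended Rauzy class of `p`: the class of `p` for the smallest equivalence
relation that is closed under right and left Rauzy moves. -/
def extClass (p : RauzyPair A) : Set (RauzyPair A) :=
  {q | Relation.EqvGen ExtStep p q}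

/-- The permutation `p₁ ∘ p₀⁻¹` of the `#A` positions. -/
def toPerm (p : RauzyPair A) : Equiv.Perm (Fin (Fintype.card A)) :=
  (p.row 0).symm.trans (p.row 1)

/-- The non-labeled extended Rauzy class of `p`. -/
def extClassNonLabeled (p : RauzyPair A) : Set (Equiv.Perm (Fin (Fintype.card A))) :=
  toPerm '' p.extClass

/-- The map `S(p) : A → A`. -/
def S [Nonempty A] (p : RauzyPair A) (α : A) : A :=
  if p.pos 1 α = 1 then
    p.letter 0 1
  else if p.pos 1 α = p.pos 1 (p.letter 0 (Fintype.card A)) + 1 then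
    p.letter 0 (p.pos 0 (p.letter 1 (Fintype.card A)) + 1)
  else
    p.letter 0 (p.pos 0 (p.letter 1 (p.pos 1 α - 1)) + 1)

/-- The map `Y(p)`, to be used on the letters other than `p₀⁻¹(1)`: the first return of `S(p)`
to that set. -/
def Y [Nonempty A] (p : RauzyPair A) (b : A) : A :=
  if p.pos 1 b = 1 then p.S (p.S b) else p.S b

/-- The unordered list `P(p)` of the lengths, with multiplicity, of the cycles of `Y(p)` on
`A \ {p₀⁻¹(1)}`. (`Function.periodicOrbit f x` is the cycle of `x` under `f`.) -/
noncomputable def P [Nonempty A] [DecidableEq A] (p : RauzyPair A) : Multiset ℕ :=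
  ((Finset.univ.erase (p.letter 0 1)).image (Function.periodicOrbit p.Y)).val.map Cycle.length

/-- Standard pairs: the first letter of each row is the last letter of the other row. -/
def IsStandard (p : RauzyPair A) : Prop :=
  ∀ ε : Fin 2, ∃ a : A, p.pos ε a = 1 ∧ p.pos (1 - ε) a = Fintype.card A

/-- The numbers `2 = k₀ < k₁ < …` with `k_i - k_{i-1}` the `i`-th entry of `L`. -/
def boundary (L : List ℕ) (i : ℕ) : ℕ := 2 + (L.take i).sum

/-- `p` is piece-wise order reversing and its order reversing blocks, from left to right, have
the sizes listed in `L`. The list `L` is determined by `p`. -/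
def HasBlocks (p : RauzyPair A) (L : List ℕ) : Prop :=
  p.IsStandard ∧ (∀ s ∈ L, 0 < s) ∧ boundary L L.length = Fintype.card A ∧
  ∀ i < L.length,
    {b : A | boundary L i ≤ p.pos 0 b ∧ p.pos 0 b < boundary L (i + 1)} =
      {b : A | boundary L i ≤ p.pos 1 b ∧ p.pos 1 b < boundary L (i + 1)} ∧
    ∀ b : A, boundary L i ≤ p.pos 0 b → p.pos 0 b < boundary L (i + 1) →
      p.pos 0 b + p.pos 1 b + 1 = boundary L i + boundary L (i + 1)

/-- The chain decomposition of the list of block sizes: the (possibly empty) chains are the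
maximal runs of blocks between the `1`-blocks, e.g. `[2, 1, 1, 4, 2]` gives `[[2], [], [4, 2]]`. -/
def chains (L : List ℕ) : List (List ℕ) := L.splitOn 1

/-- More than one block has size two or greater. -/
def ManyBlocks (L : List ℕ) : Prop := 2 ≤ (L.filter (fun s => 2 ≤ s)).length

/-- At most one chain is non-empty, and it is composed of one block. -/
def Type1 (L : List ℕ) : Prop :=
  ((chains L).filter (fun C => C ≠ [])).length ≤ 1 ∧ ∀ C ∈ chains L, C ≠ [] → C.length = 1

/-- All non-empty chains are composed of `2`-blocks. -/
def Type2 (L : List ℕ) : Prop :=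
  ManyBlocks L ∧ ∀ C ∈ chains L, ∀ s ∈ C, s = 2

/-- A chain of `m ≥ 0` blocks of size two, then a `3`-block, then `l ≥ 0` blocks of size two. -/
def IsThreeChain (C : List ℕ) : Prop :=
  ∃ m l : ℕ, C = List.replicate m 2 ++ 3 :: List.replicate l 2

/-- Each non-empty chain is a chain of `2`-blocks or contains, besides `2`-blocks, exactly one
`3`-block; and at least one chain is of the latter form. -/
def Type3 (L : List ℕ) : Prop :=
  ManyBlocks L ∧
  (∀ C ∈ chains L, C ≠ [] → IsThreeChain C ∨ ∃ m : ℕ, 0 < m ∧ C = List.replicate m 2) ∧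
  ∃ C ∈ chains L, IsThreeChain C

/-- Exactly one chain is a `4`-block followed by `m ≥ 0` blocks of size two; the other non-empty
chains are composed of `2`-blocks. -/
def Type4 (L : List ℕ) : Prop :=
  ManyBlocks L ∧
  ∃ (l r : List (List ℕ)) (m : ℕ), chains L = l ++ (4 :: List.replicate m 2) :: r ∧
    ∀ C ∈ l ++ r, ∀ s ∈ C, s = 2

/-- Exactly one chain is a single `5`-block; the other non-empty chains are single `2`-blocks. -/
def Type5 (L : List ℕ) : Prop :=
  ManyBlocks L ∧
  ∃ l r : List (List ℕ), chains L = l ++ [5] :: r ∧ ∀ C ∈ l ++ r, C ≠ [] → C = [2]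

/-- The five Types. -/
inductive TypeLabel
  | one | two | three | four | five

/-- The condition on the block sizes that defines each Type. -/
def BlocksOfType : TypeLabel → List ℕ → Prop
  | .one => Type1
  | .two => Type2
  | .three => Type3
  | .four => Type4
  | .five => Type5

/-- `p` is a piece-wise order reversing pair of Type `x`. -/
def IsOfType (p : RauzyPair A) (x : TypeLabel) : Prop :=
  ∃ L : List ℕ, p.HasBlocks L ∧ BlocksOfType x L

/-- `p` has Type `x` through its extended Rauzy class: the class contains a piece-wise order
reversing pair of Type `x` (for instance `p` itself, see `IsOfType.hasType`). -/
def HasType (p : RauzyPair A) (x : TypeLabel) : Prop :=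
  ∃ p' ∈ p.extClass, p'.IsOfType x

theorem IsOfType.hasType {p : RauzyPair A} {x : TypeLabel} (h : p.IsOfType x) : p.HasType x :=
  ⟨p, Relation.EqvGen.refl p, h⟩

end RauzyPair

/-! The proof has three ingredients. First, `P` is constant on extended Rauzy classes: right moves
do not change `S`, left moves of type zero do not change `Y` away from the first letter of the first
row, and left moves of type one conjugate `Y` by a permutation of the letters (`P_eq_of_extStep`).
Second, for a piece-wise order reversing pair the cycle lengths of `Y` depend on the block sizes
only (`P_eq_blockCycles`). Third, two lists of block sizes of the same Type, with the same sum and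
the same cycle lengths, are joined by Rauzy moves (`BlocksOfType.blockConn`). Two pairs with the
same block sizes differ by a renaming of letters, which the non-labeled class does not see.

For the third point, a letter `a` that opens the first row and closes the second turns the rest of
the rows into two cyclic words which the moves rotate independently. The basic operation is
`CycConn.switch`: if three letters have the same cyclic order in both words, two of the segments
that they start can be exchanged in both words at once. In a standard pair the other end letter `z`
behaves like one more `1`-block, so the chains sit on a circle separated by `1`-blocks, and
switching at these separators permutes them freely (`ChainConn.of_perm`).

A chain of `m` `2`-blocks contributes one cycle of length `2m+1`, a `4`-block followed by `m`
`2`-blocks one of length `2m+5`, and a `3`-block between `m` and `l` `2`-blocks two of lengths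
`2m+2` and `2l+2`. In Types 1, 2 and 5 the cycle lengths and the sum of the sizes therefore
determine the chains up to order. In Type 4 they do not tell which cycle belongs to the `4`-block,
and `BlockConn.four_exchange` moves it. In Type 3 they do not tell how the even lengths are paired
into chains; reversing a chain and exchanging the inner ends of two chains realise all pairings
(`ChainConn.threeChains_perm`). -/

namespace RauzyPair

/-! ### Rauzy moves on words and cyclic words -/

/-- The right and left Rauzy moves, written on the two rows of letters. -/
inductive WordStep {A : Type*} : List A × List A → List A × List A → Prop
  | rightZero (X Y Z : List A) (z w : A) :
      WordStep (X ++ [z], Y ++ z :: (Z ++ [w])) (X ++ [z], Y ++ z :: w :: Z)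
  | rightOne (X Y Z : List A) (z w : A) :
      WordStep (Y ++ z :: (Z ++ [w]), X ++ [z]) (Y ++ z :: w :: Z, X ++ [z])
  | leftZero (X Y Z : List A) (z w : A) :
      WordStep (z :: X, w :: (Z ++ z :: Y)) (z :: X, Z ++ w :: z :: Y)
  | leftOne (X Y Z : List A) (z w : A) :
      WordStep (w :: (Z ++ z :: Y), z :: X) (Z ++ w :: z :: Y, z :: X)

/-- Pairs of words connected by Rauzy moves. -/
def WordConn {A : Type*} : List A × List A → List A × List A → Prop :=
  Relation.EqvGen WordStep

namespace WordConn

variable {A : Type*}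

theorem refl (u : List A × List A) : WordConn u u := Relation.EqvGen.refl u

theorem trans {u v w : List A × List A} (h : WordConn u v) (h' : WordConn v w) : WordConn u w :=
  Relation.EqvGen.trans _ _ _ h h'

/-- One right move carries the last letter to the place just behind `z`; doing this for each letter
of `V`, from its end, is the rotation. -/
theorem rotate_top_right (X Y : List A) (z : A) (U V : List A) :
    WordConn (Y ++ z :: (U ++ V), X ++ [z]) (Y ++ z :: (V ++ U), X ++ [z]) := by
  induction V using List.reverseRecOn generalizing U with
  | nil => simpa using refl _
  | append_singleton V w ih =>
    have h := WordStep.rightOne X Y (U ++ V) z w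
    have h2 := ih (w :: U)
    refine trans (Relation.EqvGen.rel _ _ (by simpa using h)) (by simpa using h2)

theorem rotate_bottom_left (X Y : List A) (z : A) (U V : List A) :
    WordConn (z :: X, U ++ V ++ z :: Y) (z :: X, V ++ U ++ z :: Y) := by
  induction U generalizing V with
  | nil => simpa using refl _
  | cons w U ih =>
    have h := WordStep.leftZero X Y (U ++ V) z w
    have h2 := ih (V ++ [w])
    refine trans (Relation.EqvGen.rel _ _ (by simpa using h)) (by simpa using h2)

theorem rotate_top_left (X Y : List A) (z : A) (U V : List A) :
    WordConn (U ++ V ++ z :: Y, z :: X) (V ++ U ++ z :: Y, z :: X) := by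
  induction U generalizing V with
  | nil => simpa using refl _
  | cons w U ih =>
    have h := WordStep.leftOne X Y (U ++ V) z w
    have h2 := ih (V ++ [w])
    refine trans (Relation.EqvGen.rel _ _ (by simpa using h)) (by simpa using h2)

end WordConn

/-- Connection of cyclic words: the letter `a` opens the first row and closes the second one. -/
def CycConn {A : Type*} (a : A) (T B T' B' : List A) : Prop :=
  WordConn (a :: T, B ++ [a]) (a :: T', B' ++ [a])

namespace CycConn

variable {A : Type*} {a : A} {T B T' B' T'' B'' : List A}

theorem refl (T B : List A) : CycConn a T B T B := WordConn.refl _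

theorem trans (h : CycConn a T B T' B') (h' : CycConn a T' B' T'' B'') :
    CycConn a T B T'' B'' := WordConn.trans h h'

/-- Right moves of type one turn the first word behind `a`, left moves of type zero turn the second
one in front of `a`. Each kind fixes the other row, so the two cuts are independent. -/
theorem rotate (X Y X' Y' : List A) : CycConn a (X ++ Y) (X' ++ Y') (Y ++ X) (Y' ++ X') := by
  have h1 := WordConn.rotate_top_right (X' ++ Y') [] a X Y
  have h2 := WordConn.rotate_bottom_left (Y ++ X) [] a X' Y'
  exact WordConn.trans h1 h2

/-- The letter `a` gives up the front of the first row for a moment: left moves are made around `d`,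
then `e`, then `c`, each of which opens one of the rows at that time, and the last rotation brings
`a` back. -/
theorem switch_aux (c d e : A) (v₁ v₂ u s₁ s₂ t : List A) :
    CycConn a (v₁ ++ e :: (v₂ ++ d :: (u ++ [c]))) (d :: (t ++ c :: (s₂ ++ e :: s₁)))
      (v₁ ++ d :: (u ++ e :: (v₂ ++ [c]))) (c :: (s₂ ++ d :: (t ++ e :: s₁))) := by
  have h1 := WordConn.rotate_top_left (t ++ c :: (s₂ ++ e :: (s₁ ++ [a]))) (u ++ [c]) d
    (a :: v₁) (e :: v₂)
  have h2 := WordConn.rotate_bottom_left (v₂ ++ a :: (v₁ ++ d :: (u ++ [c]))) (s₁ ++ [a]) e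
    (d :: t) (c :: s₂)
  have h3 := WordConn.rotate_top_left (s₂ ++ d :: (t ++ e :: (s₁ ++ [a]))) [] c
    (e :: v₂) (a :: (v₁ ++ d :: u))
  unfold CycConn
  refine WordConn.trans (by simpa using h1) (WordConn.trans (by simpa using h2) ?_)
  simpa using h3

/-- Three letters in the same cyclic order in both cyclic words: the segments that start with
two of them may be exchanged. -/
theorem switch (c d e : A) (U V W U' V' W' : List A) :
    CycConn a (c :: (U ++ d :: (V ++ e :: W))) (c :: (U' ++ d :: (V' ++ e :: W')))
      (c :: (U ++ e :: (W ++ d :: V))) (c :: (U' ++ e :: (W' ++ d :: V'))) := by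
  have h1 := rotate (a := a) [c] (U ++ d :: (V ++ e :: W)) (c :: (U' ++ d :: V')) (e :: W')
  have h2 := switch_aux (a := a) c e d U V W V' U' W'
  have h3 := rotate (a := a) (U ++ e :: (W ++ d :: V)) [c] [] (c :: (U' ++ e :: (W' ++ d :: V')))
  exact trans (by simpa using h1) (trans (by simpa using h2) (by simpa using h3))

end CycConn

end RauzyPair

/-! ### Words reversed block by block, and moves between lists of block sizes -/

namespace RauzyPair

/-- `Blocks L W W'`: the word `W` is cut into blocks with the lengths in `L`, and `W'` is obtained
by reversing each block. -/
inductive Blocks {A : Type*} : List ℕ → List A → List A → Prop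
  | nil : Blocks [] [] []
  | cons (c : List A) {L : List ℕ} {W W' : List A} (h : Blocks L W W') :
      Blocks (c.length :: L) (c ++ W) (c.reverse ++ W')

namespace Blocks

variable {A : Type*}

theorem append {L₁ L₂ : List ℕ} {V V' W W' : List A} (h₁ : Blocks L₁ V V')
    (h₂ : Blocks L₂ W W') : Blocks (L₁ ++ L₂) (V ++ W) (V' ++ W') := by
  induction h₁ with
  | nil => simpa using h₂
  | cons c h ih => simpa using Blocks.cons c ih

theorem exists_of_cons {s : ℕ} {L : List ℕ} {W W' : List A} (h : Blocks (s :: L) W W') :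
    ∃ c V V', c.length = s ∧ W = c ++ V ∧ W' = c.reverse ++ V' ∧ Blocks L V V' := by
  cases h with
  | cons c h => exact ⟨c, _, _, rfl, rfl, rfl, h⟩

theorem exists_of_append {L₁ L₂ : List ℕ} {W W' : List A} (h : Blocks (L₁ ++ L₂) W W') :
    ∃ U U' V V', W = U ++ V ∧ W' = U' ++ V' ∧ Blocks L₁ U U' ∧ Blocks L₂ V V' := by
  induction L₁ generalizing W W' with
  | nil => exact ⟨[], [], W, W', rfl, rfl, .nil, h⟩
  | cons s L ih =>
    obtain ⟨c, V, V', rfl, rfl, rfl, h₁⟩ := exists_of_cons h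
    obtain ⟨U, U', Q, Q', rfl, rfl, h1, h2⟩ := ih h₁
    exact ⟨c ++ U, c.reverse ++ U', Q, Q', by simp, by simp, .cons c h1, h2⟩

theorem one (x : A) : Blocks [1] [x] [x] := by simpa using Blocks.cons [x] .nil

theorem two (x y : A) : Blocks [2] [x, y] [y, x] := by simpa using Blocks.cons [x, y] .nil

theorem three (x y z : A) : Blocks [3] [x, y, z] [z, y, x] := by
  simpa using Blocks.cons [x, y, z] .nil

theorem four (x y z w : A) : Blocks [4] [x, y, z, w] [w, z, y, x] := by
  simpa using Blocks.cons [x, y, z, w] .nil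

theorem exists_of_one {L : List ℕ} {W W' : List A} (h : Blocks (1 :: L) W W') :
    ∃ x V V', W = x :: V ∧ W' = x :: V' ∧ Blocks L V V' := by
  obtain ⟨c, V, V', hc, rfl, rfl, h₁⟩ := exists_of_cons h
  obtain ⟨x, rfl⟩ := List.length_eq_one_iff.1 hc
  exact ⟨x, V, V', by simp, by simp, h₁⟩

theorem exists_of_two {L : List ℕ} {W W' : List A} (h : Blocks (2 :: L) W W') :
    ∃ x y V V', W = x :: y :: V ∧ W' = y :: x :: V' ∧ Blocks L V V' := by
  obtain ⟨c, V, V', hc, rfl, rfl, h₁⟩ := exists_of_cons h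
  obtain ⟨x, y, rfl⟩ := List.length_eq_two.1 hc
  exact ⟨x, y, V, V', by simp, by simp, h₁⟩

theorem exists_of_three {L : List ℕ} {W W' : List A} (h : Blocks (3 :: L) W W') :
    ∃ x y z V V', W = x :: y :: z :: V ∧ W' = z :: y :: x :: V' ∧ Blocks L V V' := by
  obtain ⟨c, V, V', hc, rfl, rfl, h₁⟩ := exists_of_cons h
  obtain ⟨x, y, z, rfl⟩ := List.length_eq_three.1 hc
  exact ⟨x, y, z, V, V', by simp, by simp, h₁⟩

theorem exists_of_four {L : List ℕ} {W W' : List A} (h : Blocks (4 :: L) W W') :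
    ∃ x y z w V V', W = x :: y :: z :: w :: V ∧ W' = w :: z :: y :: x :: V' ∧
      Blocks L V V' := by
  obtain ⟨c, V, V', hc, rfl, rfl, h₁⟩ := exists_of_cons h
  match c, hc, h₁ with
  | [x, y, z, w], _, h₁ => exact ⟨x, y, z, w, V, V', by simp, by simp, h₁⟩

theorem nil_right {W W' : List A} (h : Blocks [] W W') : W = [] ∧ W' = [] := by
  cases h; exact ⟨rfl, rfl⟩

end Blocks

namespace CycConn

variable {A : Type*} {a : A}

/-- A run of `2`-blocks that stands before `b` in one word and behind `g` in the other changes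
sides: behind the successor of `g` in the first word, before `b` in the second. The letters are
regrouped into new `2`-blocks on the way, hence the existential `g'`, `Z`, `Z'`. -/
theorem flip {k : ℕ} {Y Y' : List A} (hY : Blocks (List.replicate k 2) Y Y') (b g : A)
    (O Q R S : List A) :
    ∃ g' Z Z', Blocks (List.replicate k 2) Z Z' ∧
      CycConn a (Y ++ b :: (O ++ g :: Q)) (g :: (Y' ++ (R ++ b :: S)))
        (b :: (O ++ g' :: (Z ++ Q))) (g' :: (R ++ (Z' ++ b :: S))) := by
  induction k generalizing Y Y' g O Q R S with
  | zero =>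
    obtain ⟨rfl, rfl⟩ := hY.nil_right
    exact ⟨g, [], [], .nil, by simpa using CycConn.rotate (a := a) [] (b :: (O ++ g :: Q)) [] _⟩
  | succ k ih =>
    rw [List.replicate_succ'] at hY
    obtain ⟨Y, Y', V, V', rfl, rfl, hY₁, hV⟩ := hY.exists_of_append
    obtain ⟨c, d, V, V', rfl, rfl, hV₁⟩ := hV.exists_of_two
    obtain ⟨rfl, rfl⟩ := hV₁.nil_right
    have r1 := CycConn.rotate (a := a) Y (c :: d :: b :: (O ++ g :: Q)) (g :: (Y' ++ [d]))
      (c :: (R ++ b :: S))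
    -- The last `2`-block `c d` is peeled off; `c`, `b`, `g` now have the same cyclic order in both
    -- words.
    have h1 := CycConn.switch (a := a) c b g [d] O (Q ++ Y) R S (Y' ++ [d])
    have r2 := CycConn.rotate (a := a) (c :: d :: g :: Q) (Y ++ b :: O) (c :: R)
      (g :: (Y' ++ d :: b :: S))
    obtain ⟨g', Z, Z', hZ, h2⟩ := ih hY₁ g (O ++ [c, d]) Q [d] (S ++ c :: R)
    have r3 := CycConn.rotate (a := a) [] (b :: (O ++ c :: d :: g' :: (Z ++ Q)))
      (g' :: d :: (Z' ++ b :: S)) (c :: R)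
    -- The place of `g` is taken by `c`, and `d` forms a new `2`-block with the letter `g'` of the
    -- shorter run.
    refine ⟨c, d :: g' :: Z, g' :: d :: Z', (Blocks.two d g').append hZ, ?_⟩
    simp only [List.append_assoc, List.cons_append, List.nil_append, List.append_nil] at *
    exact r1.trans (h1.trans (r2.trans (h2.trans r3)))

/-- The transport opposite to `flip`, for prescribed blocks at the start; here the first `2`-block
is peeled off. -/
theorem flip_symm {k : ℕ} {Y Y' : List A} (hY : Blocks (List.replicate k 2) Y Y') (b g : A)
    (O Q R S : List A) :
    ∃ g' Z Z', Blocks (List.replicate k 2) Z Z' ∧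
      CycConn a (b :: (O ++ g :: (Y ++ Q))) (g :: (R ++ (Y' ++ b :: S)))
        (Z ++ b :: (O ++ g' :: Q)) (g' :: (Z' ++ (R ++ b :: S))) := by
  induction k generalizing Y Y' b g O Q R S with
  | zero =>
    obtain ⟨rfl, rfl⟩ := hY.nil_right
    exact ⟨g, [], [], .nil, by simpa using CycConn.rotate (a := a) [] (b :: (O ++ g :: Q)) [] _⟩
  | succ k ih =>
    rw [List.replicate_succ] at hY
    obtain ⟨c, d, Y, Y', rfl, rfl, hY₁⟩ := hY.exists_of_two
    have r1 := CycConn.rotate (a := a) (b :: O) (g :: c :: d :: (Y ++ Q)) []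
      (g :: (R ++ d :: c :: (Y' ++ b :: S)))
    have h1 := CycConn.switch (a := a) g d b [c] (Y ++ Q) O R (c :: Y') S
    have r2 := CycConn.rotate (a := a) [] (g :: c :: b :: (O ++ d :: (Y ++ Q)))
      (g :: (R ++ b :: S)) (d :: c :: Y')
    obtain ⟨g', Z, Z', hZ, h2⟩ := ih hY₁ g d (c :: b :: O) Q [c] (R ++ b :: S)
    refine ⟨g', Z ++ [g, c], Z' ++ [c, g], ?_, ?_⟩
    · rw [List.replicate_succ']
      exact hZ.append (Blocks.two g c)
    simp only [List.append_assoc, List.cons_append, List.nil_append, List.append_nil] at *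
    exact r1.trans (h1.trans (r2.trans h2))

end CycConn

/-- The cyclic words of the piece-wise order reversing pairs with block sizes `L`. -/
def BlockForm {A : Type*} (L : List ℕ) (T B : List A) : Prop :=
  ∃ z W W', Blocks L W W' ∧ T = z :: W ∧ B = z :: W'

/-- Every pair with block sizes `L` is connected to a pair with block sizes `L'`. -/
def BlockConn (A : Type*) (L L' : List ℕ) : Prop :=
  ∀ (a : A) (T B : List A), BlockForm L T B →
    ∃ T' B', BlockForm L' T' B' ∧ CycConn a T B T' B'

namespace BlockConn

variable {A : Type*} {L L' L'' : List ℕ}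

theorem refl (L : List ℕ) : BlockConn A L L := fun _ T B h => ⟨T, B, h, CycConn.refl T B⟩

theorem trans (h : BlockConn A L L') (h' : BlockConn A L' L'') : BlockConn A L L'' := by
  intro a T B hT
  obtain ⟨T', B', hT', hc⟩ := h a T B hT
  obtain ⟨T'', B'', hT'', hc'⟩ := h' a T' B' hT'
  exact ⟨T'', B'', hT'', hc.trans hc'⟩

/-- The leading letter `z` is shared by both words, as is the letter of any `1`-block, so that
letter can take over the role of `z`. -/
theorem rotate (L₀ L₁ : List ℕ) : BlockConn A (L₀ ++ 1 :: L₁) (L₁ ++ 1 :: L₀) := by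
  rintro a T B ⟨z, W, W', hW, rfl, rfl⟩
  obtain ⟨U, U', V, V', rfl, rfl, hU, hV⟩ := hW.exists_of_append
  obtain ⟨y, V, V', rfl, rfl, hV₁⟩ := hV.exists_of_one
  refine ⟨_, _, ⟨y, _, _, hV₁.append ((Blocks.one z).append hU), rfl, rfl⟩, ?_⟩
  simpa using CycConn.rotate (a := a) (z :: U) (y :: V) (z :: U') (y :: V')

/-- This is one switch at the three separators `z`, `y`, `x`. -/
theorem swap (L₀ L₁ L₂ : List ℕ) :
    BlockConn A (L₀ ++ 1 :: (L₁ ++ 1 :: L₂)) (L₁ ++ 1 :: (L₀ ++ 1 :: L₂)) := by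
  rintro a T B ⟨z, W, W', hW, rfl, rfl⟩
  obtain ⟨U, U', V, V', rfl, rfl, hU, hV⟩ := hW.exists_of_append
  obtain ⟨y, V, V', rfl, rfl, hV₁⟩ := hV.exists_of_one
  obtain ⟨V, V', X, X', rfl, rfl, hV₂, hX⟩ := hV₁.exists_of_append
  obtain ⟨x, X, X', rfl, rfl, hX₁⟩ := hX.exists_of_one
  refine ⟨_, _, ⟨y, _, _, hV₂.append ((Blocks.one z).append (hU.append
    ((Blocks.one x).append hX₁))), rfl, rfl⟩, ?_⟩
  have h1 := CycConn.switch (a := a) z y x U V X U' V' X'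
  have r2 := CycConn.rotate (a := a) (z :: (U ++ x :: X)) (y :: V) (z :: (U' ++ x :: X'))
    (y :: V')
  simp only [List.append_assoc, List.cons_append, List.nil_append] at *
  exact h1.trans r2

/-- Four switches, with rotations between them, trade the `4`-block for the two `2`-blocks behind a
`1`-block. The intermediate words are not block reversals; the blocks of the witness are read off
the last pair of words. -/
theorem four_exchange (L₀ L₁ : List ℕ) :
    BlockConn A (4 :: (L₀ ++ 1 :: 2 :: 2 :: L₁)) (2 :: 2 :: (L₀ ++ 1 :: 4 :: L₁)) := by
  rintro o T B ⟨z, W, W', hW, rfl, rfl⟩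
  obtain ⟨c0, c1, c2, c3, V, V', rfl, rfl, hV⟩ := hW.exists_of_four
  obtain ⟨Q, Q', V, V', rfl, rfl, hQ, hV₁⟩ := hV.exists_of_append
  obtain ⟨c4, V, V', rfl, rfl, hV₂⟩ := hV₁.exists_of_one
  obtain ⟨c5, c6, V, V', rfl, rfl, hV₂₁⟩ := hV₂.exists_of_two
  obtain ⟨c7, c8, R, R', rfl, rfl, hR⟩ := hV₂₁.exists_of_two
  refine ⟨_, _, ⟨z, _, _, (Blocks.two c2 c1).append ((Blocks.two c0 c3).append (hQ.append
    ((Blocks.one c4).append ((Blocks.four c7 c6 c5 c8).append hR)))), rfl, rfl⟩, ?_⟩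
  have r1 := CycConn.rotate (a := o) [z] (c0 :: (c1 :: (c2 :: (c3 :: (Q ++ (c4 :: (c5 :: (c6 ::
    (c7 :: (c8 :: R)))))))))) [z, c3, c2, c1] (c0 :: (Q' ++ (c4 :: (c6 :: (c5 :: (c8 :: (c7 ::
    R')))))))
  have h1 := CycConn.switch (a := o) c0 c5 c7 (c1 :: (c2 :: (c3 :: (Q ++ [c4])))) [c6] (c8 :: (R
    ++ [z])) (Q' ++ [c4, c6]) [c8] (R' ++ [z, c3, c2, c1])
  have r2 := CycConn.rotate (a := o) [c0] (c1 :: (c2 :: (c3 :: (Q ++ (c4 :: (c7 :: (c8 :: (R ++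
    [z, c5, c6])))))))) (c0 :: (Q' ++ (c4 :: (c6 :: (c7 :: (R' ++ [z, c3, c2])))))) [c1, c5, c8]
  have h2 := CycConn.switch (a := o) c1 c8 c6 (c2 :: (c3 :: (Q ++ [c4, c7]))) (R ++ [z, c5])
    [c0] [c5] (c0 :: (Q' ++ [c4])) (c7 :: (R' ++ [z, c3, c2]))
  have r3 := CycConn.rotate (a := o) [c1] (c2 :: (c3 :: (Q ++ (c4 :: (c7 :: (c6 :: (c0 :: (c8 ::
    (R ++ [z, c5]))))))))) (c1 :: (c5 :: (c6 :: (c7 :: (R' ++ [z, c3]))))) (c2 :: (c8 :: (c0 ::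
    (Q' ++ [c4]))))
  have h3 := CycConn.switch (a := o) c2 c0 c5 (c3 :: (Q ++ [c4, c7, c6])) (c8 :: (R ++ [z]))
    [c1] [c8] (Q' ++ [c4, c1]) (c6 :: (c7 :: (R' ++ [z, c3])))
  have r4 := CycConn.rotate (a := o) [c2] (c3 :: (Q ++ (c4 :: (c7 :: (c6 :: (c5 :: (c1 :: (c0 ::
    (c8 :: (R ++ [z])))))))))) (c2 :: (c8 :: (c5 :: (c6 :: (c7 :: (R' ++ [z])))))) (c3 :: (c0 ::
    (Q' ++ [c4, c1])))
  have h4 := CycConn.switch (a := o) c3 c1 c8 (Q ++ [c4, c7, c6, c5]) [c0] (R ++ [z, c2]) (c0 ::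
    (Q' ++ [c4])) [c2] (c5 :: (c6 :: (c7 :: (R' ++ [z]))))
  have r5 := CycConn.rotate (a := o) (c3 :: (Q ++ (c4 :: (c7 :: (c6 :: (c5 :: (c8 :: R)))))))
    [z, c2, c1, c0] (c3 :: (c0 :: (Q' ++ (c4 :: (c8 :: (c5 :: (c6 :: (c7 :: R')))))))) [z, c1,
    c2]
  simp only [List.append_assoc, List.cons_append, List.nil_append] at *
  exact r1.trans (h1.trans (r2.trans (h2.trans (r3.trans (h3.trans (r4.trans (h4.trans r5)))))))

/-- A switch at `z`, `c0`, `c2` breaks up the `3`-block and the `2`-block before it, and makes both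
remaining runs of `2`-blocks accessible to `flip`. The pieces reassemble as the `3`-block `c3 c4 c0`
and the `2`-block `c1 g0`. -/
theorem three_reverse (m l : ℕ) :
    BlockConn A (List.replicate (m + 1) 2 ++ 3 :: List.replicate l 2)
      (List.replicate l 2 ++ 3 :: List.replicate (m + 1) 2) := by
  rintro o T B ⟨z, W, W', hW, rfl, rfl⟩
  rw [List.replicate_succ', List.append_assoc, List.singleton_append] at hW
  obtain ⟨P, P', V, V', rfl, rfl, hP, hV⟩ := hW.exists_of_append
  obtain ⟨c0, c1, V, V', rfl, rfl, hV₁⟩ := hV.exists_of_two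
  obtain ⟨c2, c3, c4, Q, Q', rfl, rfl, hQ⟩ := hV₁.exists_of_three
  have r1 := CycConn.rotate (a := o) [] (z :: (P ++ (c0 :: (c1 :: (c2 :: (c3 :: (c4 :: Q)))))))
    [] (z :: (P' ++ (c1 :: (c0 :: (c4 :: (c3 :: (c2 :: Q')))))))
  have h1 := CycConn.switch (a := o) z c0 c2 P [c1] (c3 :: (c4 :: Q)) (P' ++ [c1]) [c4, c3] Q'
  have r2 := CycConn.rotate (a := o) [z] (P ++ (c2 :: (c3 :: (c4 :: (Q ++ [c0, c1]))))) [] (z ::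
    (P' ++ (c1 :: (c2 :: (Q' ++ [c0, c4, c3])))))
  obtain ⟨g0, P1, P1', hP1, h2⟩ := CycConn.flip (a := o) hP c2 z (c3 :: (c4 :: (Q ++ [c0, c1])))
    [] [c1] (Q' ++ [c0, c4, c3])
  have r3 := CycConn.rotate (a := o) [c2, c3, c4] (Q ++ (c0 :: (c1 :: (g0 :: P1)))) (g0 :: (c1
    :: P1')) (c2 :: (Q' ++ [c0, c4, c3]))
  obtain ⟨g1, Q1, Q1', hQ1, h3⟩ := CycConn.flip (a := o) hQ c0 c2 (c1 :: (g0 :: P1)) [c3, c4] []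
    (c4 :: (c3 :: (g0 :: (c1 :: P1'))))
  have r4 := CycConn.rotate (a := o) (c0 :: (c1 :: (g0 :: P1))) (g1 :: (Q1 ++ [c3, c4])) [] (g1
    :: (Q1' ++ (c0 :: (c4 :: (c3 :: (g0 :: (c1 :: P1')))))))
  refine ⟨_, _, ⟨g1, _, _, hQ1.append ((Blocks.three c3 c4 c0).append
    ((Blocks.two c1 g0).append hP1)), rfl, rfl⟩, ?_⟩
  simp only [List.append_assoc, List.cons_append, List.nil_append, List.append_nil] at *
  exact r1.trans (h1.trans (r2.trans (h2.trans (r3.trans (h3.trans r4)))))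

/-- When other chains follow, the end of this chain no longer meets `z` on the circle. Two switches
through the letter `c5` of the next `1`-block replace the single one of `three_reverse`. -/
theorem three_reverse_append (m l : ℕ) (L : List ℕ) :
    BlockConn A (List.replicate (m + 1) 2 ++ 3 :: (List.replicate l 2 ++ 1 :: L))
      (List.replicate l 2 ++ 3 :: (List.replicate (m + 1) 2 ++ 1 :: L)) := by
  rintro o T B ⟨z, W, W', hW, rfl, rfl⟩
  rw [List.replicate_succ', List.append_assoc, List.singleton_append] at hW
  obtain ⟨P, P', V, V', rfl, rfl, hP, hV⟩ := hW.exists_of_append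
  obtain ⟨c0, c1, V, V', rfl, rfl, hV₁⟩ := hV.exists_of_two
  obtain ⟨c2, c3, c4, V, V', rfl, rfl, hV₂⟩ := hV₁.exists_of_three
  obtain ⟨Q, Q', V, V', rfl, rfl, hQ, hV₂₁⟩ := hV₂.exists_of_append
  obtain ⟨c5, X, X', rfl, rfl, hX⟩ := hV₂₁.exists_of_one
  have r1 := CycConn.rotate (a := o) (z :: P) (c0 :: (c1 :: (c2 :: (c3 :: (c4 :: (Q ++ (c5 ::
    X))))))) (z :: (P' ++ [c1])) (c0 :: (c4 :: (c3 :: (c2 :: (Q' ++ (c5 :: X'))))))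
  have h1 := CycConn.switch (a := o) c0 c2 c5 [c1] (c3 :: (c4 :: Q)) (X ++ (z :: P)) [c4, c3] Q'
    (X' ++ (z :: (P' ++ [c1])))
  have r2 := CycConn.rotate (a := o) [c0, c1] (c5 :: (X ++ (z :: (P ++ (c2 :: (c3 :: (c4 ::
    Q))))))) [c0, c4, c3] (c5 :: (X' ++ (z :: (P' ++ (c1 :: (c2 :: Q'))))))
  have h2 := CycConn.switch (a := o) c5 z c2 X P (c3 :: (c4 :: (Q ++ [c0, c1]))) X' (P' ++ [c1])
    (Q' ++ [c0, c4, c3])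
  have r3 := CycConn.rotate (a := o) (c5 :: (X ++ (c2 :: (c3 :: (c4 :: (Q ++ [c0, c1, z])))))) P
    (c5 :: (X' ++ (c2 :: (Q' ++ [c0, c4, c3])))) (z :: (P' ++ [c1]))
  obtain ⟨g2, P1, P1', hP1, h3⟩ := CycConn.flip (a := o) hP c5 z (X ++ (c2 :: (c3 :: (c4 :: (Q
    ++ [c0, c1]))))) [] [c1] (X' ++ (c2 :: (Q' ++ [c0, c4, c3])))
  have r4 := CycConn.rotate (a := o) (c5 :: (X ++ [c2, c3, c4])) (Q ++ (c0 :: (c1 :: (g2 ::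
    P1)))) (g2 :: (c1 :: (P1' ++ (c5 :: X')))) (c2 :: (Q' ++ [c0, c4, c3]))
  obtain ⟨g3, Q1, Q1', hQ1, h4⟩ := CycConn.flip (a := o) hQ c0 c2 (c1 :: (g2 :: (P1 ++ (c5 ::
    X)))) [c3, c4] [] (c4 :: (c3 :: (g2 :: (c1 :: (P1' ++ (c5 :: X'))))))
  have r5 := CycConn.rotate (a := o) (c0 :: (c1 :: (g2 :: (P1 ++ (c5 :: X))))) (g3 :: (Q1 ++
    [c3, c4])) [] (g3 :: (Q1' ++ (c0 :: (c4 :: (c3 :: (g2 :: (c1 :: (P1' ++ (c5 :: X')))))))))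
  refine ⟨_, _, ⟨g3, _, _, hQ1.append ((Blocks.three c3 c4 c0).append
    ((Blocks.two c1 g2).append (hP1.append ((Blocks.one c5).append hX)))), rfl, rfl⟩, ?_⟩
  simp only [List.append_assoc, List.cons_append, List.nil_append, List.append_nil] at *
  exact r1.trans (h1.trans (r2.trans (h2.trans (r3.trans (h3.trans (r4.trans (h4.trans r5)))))))

/-- No `2`-block precedes the `3`-block here, so the switch uses the first `2`-block behind it, and
only one run remains to be flipped. -/
theorem three_reverse_left (l : ℕ) :
    BlockConn A (3 :: List.replicate (l + 1) 2) (List.replicate (l + 1) 2 ++ [3]) := by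
  rintro o T B ⟨z, W, W', hW, rfl, rfl⟩
  rw [List.replicate_succ] at hW
  obtain ⟨c0, c1, c2, V, V', rfl, rfl, hV⟩ := hW.exists_of_three
  obtain ⟨c3, c4, Q, Q', rfl, rfl, hQ⟩ := hV.exists_of_two
  have r1 := CycConn.rotate (a := o) [] (z :: (c0 :: (c1 :: (c2 :: (c3 :: (c4 :: Q)))))) [] (z
    :: (c2 :: (c1 :: (c0 :: (c4 :: (c3 :: Q'))))))
  have h1 := CycConn.switch (a := o) z c0 c3 [] [c1, c2] (c4 :: Q) [c2, c1] [c4] Q'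
  have r2 := CycConn.rotate (a := o) [z, c3, c4] (Q ++ [c0, c1, c2]) [z, c2, c1] (c3 :: (Q' ++
    [c0, c4]))
  obtain ⟨g0, Q1, Q1', hQ1, h2⟩ := CycConn.flip (a := o) hQ c0 c3 [c1, c2, z] [c4] [] [c4, z,
    c2, c1]
  have r3 := CycConn.rotate (a := o) [c0, c1, c2, z] (g0 :: (Q1 ++ [c4])) [] (g0 :: (Q1' ++ [c0,
    c4, z, c2, c1]))
  rw [List.replicate_succ', List.append_assoc]
  refine ⟨_, _, ⟨g0, _, _, hQ1.append ((Blocks.two c4 c0).append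
    (Blocks.three c1 c2 z)), rfl, rfl⟩, ?_⟩
  simp only [List.append_assoc, List.cons_append, List.nil_append, List.append_nil] at *
  exact r1.trans (h1.trans (r2.trans (h2.trans r3)))

theorem three_reverse_left_append (l : ℕ) (L : List ℕ) :
    BlockConn A (3 :: (List.replicate (l + 1) 2 ++ 1 :: L))
      (List.replicate (l + 1) 2 ++ 3 :: 1 :: L) := by
  rintro o T B ⟨z, W, W', hW, rfl, rfl⟩
  rw [List.replicate_succ, List.cons_append] at hW
  obtain ⟨c0, c1, c2, V, V', rfl, rfl, hV⟩ := hW.exists_of_three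
  obtain ⟨c3, c4, V, V', rfl, rfl, hV₁⟩ := hV.exists_of_two
  obtain ⟨Q, Q', V, V', rfl, rfl, hQ, hV₂⟩ := hV₁.exists_of_append
  obtain ⟨c5, X, X', rfl, rfl, hX⟩ := hV₂.exists_of_one
  have r1 := CycConn.rotate (a := o) [] (z :: (c0 :: (c1 :: (c2 :: (c3 :: (c4 :: (Q ++ (c5 ::
    X)))))))) [] (z :: (c2 :: (c1 :: (c0 :: (c4 :: (c3 :: (Q' ++ (c5 :: X'))))))))
  have h1 := CycConn.switch (a := o) z c0 c3 [] [c1, c2] (c4 :: (Q ++ (c5 :: X))) [c2, c1] [c4]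
    (Q' ++ (c5 :: X'))
  have r2 := CycConn.rotate (a := o) [z] (c3 :: (c4 :: (Q ++ (c5 :: (X ++ [c0, c1, c2]))))) [z,
    c2, c1] (c3 :: (Q' ++ (c5 :: (X' ++ [c0, c4]))))
  have h2 := CycConn.switch (a := o) c3 c5 c0 (c4 :: Q) X [c1, c2, z] Q' X' [c4, z, c2, c1]
  have r3 := CycConn.rotate (a := o) [c3, c4] (Q ++ (c0 :: (c1 :: (c2 :: (z :: (c5 :: X)))))) []
    (c3 :: (Q' ++ (c0 :: (c4 :: (z :: (c2 :: (c1 :: (c5 :: X'))))))))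
  obtain ⟨g1, Q1, Q1', hQ1, h3⟩ := CycConn.flip (a := o) hQ c0 c3 (c1 :: (c2 :: (z :: (c5 ::
    X)))) [c4] [] (c4 :: (z :: (c2 :: (c1 :: (c5 :: X')))))
  have r4 := CycConn.rotate (a := o) (c0 :: (c1 :: (c2 :: (z :: (c5 :: X))))) (g1 :: (Q1 ++
    [c4])) [] (g1 :: (Q1' ++ (c0 :: (c4 :: (z :: (c2 :: (c1 :: (c5 :: X'))))))))
  rw [List.replicate_succ', List.append_assoc]
  refine ⟨_, _, ⟨g1, _, _, hQ1.append ((Blocks.two c4 c0).append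
    ((Blocks.three c1 c2 z).append ((Blocks.one c5).append hX))), rfl, rfl⟩, ?_⟩
  simp only [List.append_assoc, List.cons_append, List.nil_append, List.append_nil] at *
  exact r1.trans (h1.trans (r2.trans (h2.trans (r3.trans (h3.trans r4)))))

/-- Three switches dissolve both `3`-blocks, two applications of `flip_symm` carry the inner runs
`Q` and `R` into each other's place, and the loose letters form two new `3`-blocks. The outer parts
`M` and `S` stay as they are. -/
theorem three_exchange (k l : ℕ) (M S : List ℕ) :
    BlockConn A
      (M ++ 3 :: (List.replicate k 2 ++ 1 :: (List.replicate l 2 ++ 3 :: S)))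
      (M ++ 3 :: (List.replicate l 2 ++ 1 :: (List.replicate k 2 ++ 3 :: S))) := by
  rintro o T B ⟨z, W, W', hW, rfl, rfl⟩
  obtain ⟨M, M', V, V', rfl, rfl, hM, hV⟩ := hW.exists_of_append
  obtain ⟨c0, c1, c2, V, V', rfl, rfl, hV₁⟩ := hV.exists_of_three
  obtain ⟨Q, Q', V, V', rfl, rfl, hQ, hV₂⟩ := hV₁.exists_of_append
  obtain ⟨c3, V, V', rfl, rfl, hV₂₁⟩ := hV₂.exists_of_one
  obtain ⟨R, R', V, V', rfl, rfl, hR, hV₂₂⟩ := hV₂₁.exists_of_append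
  obtain ⟨c4, c5, c6, S, S', rfl, rfl, hS⟩ := hV₂₂.exists_of_three
  have r1 := CycConn.rotate (a := o) (z :: M) (c0 :: (c1 :: (c2 :: (Q ++ (c3 :: (R ++ (c4 :: (c5
    :: (c6 :: S))))))))) (z :: (M' ++ [c2, c1])) (c0 :: (Q' ++ (c3 :: (R' ++ (c6 :: (c5 :: (c4
    :: S')))))))
  have h1 := CycConn.switch (a := o) c0 c3 c4 (c1 :: (c2 :: Q)) R (c5 :: (c6 :: (S ++ (z ::
    M)))) Q' (R' ++ [c6, c5]) (S' ++ (z :: (M' ++ [c2, c1])))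
  have r2 := CycConn.rotate (a := o) [] (c0 :: (c1 :: (c2 :: (Q ++ (c4 :: (c5 :: (c6 :: (S ++ (z
    :: (M ++ (c3 :: R))))))))))) [] (c0 :: (Q' ++ (c4 :: (S' ++ (z :: (M' ++ (c2 :: (c1 :: (c3
    :: (R' ++ [c6, c5]))))))))))
  have h2 := CycConn.switch (a := o) c0 c1 c5 [] (c2 :: (Q ++ [c4])) (c6 :: (S ++ (z :: (M ++
    (c3 :: R))))) (Q' ++ (c4 :: (S' ++ (z :: (M' ++ [c2]))))) (c3 :: (R' ++ [c6])) []
  have r3 := CycConn.rotate (a := o) [c0] (c5 :: (c6 :: (S ++ (z :: (M ++ (c3 :: (R ++ (c1 ::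
    (c2 :: (Q ++ [c4])))))))))) (c0 :: (Q' ++ (c4 :: (S' ++ (z :: (M' ++ [c2])))))) (c5 :: (c1
    :: (c3 :: (R' ++ [c6]))))
  have h3 := CycConn.switch (a := o) c5 c6 c2 [] (S ++ (z :: (M ++ (c3 :: (R ++ [c1]))))) (Q ++
    [c4, c0]) (c1 :: (c3 :: R')) (c0 :: (Q' ++ (c4 :: (S' ++ (z :: M'))))) []
  have r4 := CycConn.rotate (a := o) (c5 :: (c2 :: Q)) (c4 :: (c0 :: (c6 :: (S ++ (z :: (M ++
    (c3 :: (R ++ [c1])))))))) (c5 :: (c1 :: (c3 :: R'))) (c2 :: (c6 :: (c0 :: (Q' ++ (c4 :: (S'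
    ++ (z :: M')))))))
  obtain ⟨g4, Q1, Q1', hQ1, h4⟩ := CycConn.flip_symm (a := o) hQ c4 c2 (c0 :: (c6 :: (S ++ (z ::
    (M ++ (c3 :: (R ++ [c1, c5]))))))) [] [c6, c0] (S' ++ (z :: (M' ++ (c5 :: (c1 :: (c3 ::
    R'))))))
  have r5 := CycConn.rotate (a := o) (Q1 ++ (c4 :: (c0 :: (c6 :: (S ++ (z :: (M ++ (c3 :: (R ++
    [c1, c5]))))))))) [g4] (g4 :: (Q1' ++ (c6 :: (c0 :: (c4 :: (S' ++ (z :: (M' ++ [c5,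
    c1])))))))) (c3 :: R')
  obtain ⟨g5, R1, R1', hR1, h5⟩ := CycConn.flip_symm (a := o) hR g4 c3 (Q1 ++ (c4 :: (c0 :: (c6
    :: (S ++ (z :: M)))))) [c1, c5] [] (Q1' ++ (c6 :: (c0 :: (c4 :: (S' ++ (z :: (M' ++ [c5,
    c1])))))))
  have r6 := CycConn.rotate (a := o) (R1 ++ (g4 :: (Q1 ++ (c4 :: (c0 :: (c6 :: S)))))) (z :: (M
    ++ [g5, c1, c5])) (g5 :: (R1' ++ (g4 :: (Q1' ++ (c6 :: (c0 :: (c4 :: S'))))))) (z :: (M' ++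
    [c5, c1]))
  refine ⟨_, _, ⟨z, _, _, hM.append ((Blocks.three g5 c1 c5).append (hR1.append
    ((Blocks.one g4).append (hQ1.append ((Blocks.three c4 c0 c6).append hS))))), rfl, rfl⟩, ?_⟩
  simp only [List.append_assoc, List.cons_append, List.nil_append, List.append_nil] at *
  exact r1.trans (h1.trans (r2.trans (h2.trans (r3.trans (h3.trans (r4.trans (h4.trans
    (r5.trans (h5.trans r6)))))))))

end BlockConn

end RauzyPair

/-! ### Rearranging chains, and their cycle lengths -/

namespace RauzyPair

/-- `BlockConn` for lists of block sizes that are given by their chains. -/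
def ChainConn (A : Type*) (Cs Ds : List (List ℕ)) : Prop :=
  BlockConn A ([1].intercalate Cs) ([1].intercalate Ds)

theorem intercalate_append {α : Type*} (x : List α) {Cs Ds : List (List α)} (hC : Cs ≠ [])
    (hD : Ds ≠ []) : x.intercalate (Cs ++ Ds) = x.intercalate Cs ++ x ++ x.intercalate Ds := by
  induction Cs with
  | nil => exact absurd rfl hC
  | cons C Cs ih =>
    by_cases h : Cs = []
    · subst h
      simp [List.intercalate_cons_of_ne_nil hD]
    · rw [List.cons_append, List.intercalate_cons_of_ne_nil (by simp [h]), ih h,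
        List.intercalate_cons_of_ne_nil h]
      simp

namespace ChainConn

variable {A : Type*} {Cs Ds Es : List (List ℕ)}

theorem refl (Cs : List (List ℕ)) : ChainConn A Cs Cs := BlockConn.refl _

theorem trans (h : ChainConn A Cs Ds) (h' : ChainConn A Ds Es) : ChainConn A Cs Es :=
  BlockConn.trans h h'

theorem rotate (Cs Ds : List (List ℕ)) : ChainConn A (Cs ++ Ds) (Ds ++ Cs) := by
  by_cases hC : Cs = []
  · subst hC; simpa using refl Ds
  by_cases hD : Ds = []
  · subst hD; simpa using refl Cs
  unfold ChainConn
  rw [intercalate_append _ hC hD, intercalate_append _ hD hC]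
  simpa using BlockConn.rotate (A := A) ([1].intercalate Cs) ([1].intercalate Ds)

theorem swap_head (C D : List ℕ) (Es : List (List ℕ)) :
    ChainConn A (C :: D :: Es) (D :: C :: Es) := by
  by_cases hE : Es = []
  · subst hE; exact rotate [C] [D]
  · unfold ChainConn
    simp only [List.intercalate_cons_cons, List.intercalate_cons_of_ne_nil hE]
    simpa using BlockConn.swap (A := A) C D ([1].intercalate Es)

/-- `swap_head` acts at the front only. The claim is therefore strengthened by a prefix `Xs`, which
is rotated to the back before a swap and returned afterwards. -/
theorem of_perm (h : Cs.Perm Ds) : ChainConn A Cs Ds := by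
  suffices H : ∀ Xs, ChainConn A (Xs ++ Cs) (Xs ++ Ds) from H []
  induction h with
  | nil => exact fun Xs => refl _
  | cons C h ih => intro Xs; simpa using ih (Xs ++ [C])
  | swap C D Cs =>
    intro Xs
    refine (rotate Xs _).trans (trans ?_ (rotate _ Xs))
    exact swap_head D C (Cs ++ Xs)
  | trans h h' ih ih' => exact fun Xs => (ih Xs).trans (ih' Xs)

/-- Since the order of chains is immaterial, the chains concerned are brought to the front and put
back. -/
theorem of_prefix (h : ∀ Xs, ChainConn A (Cs ++ Xs) (Ds ++ Xs)) (Xs Ys : List (List ℕ)) :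
    ChainConn A (Xs ++ (Cs ++ Ys)) (Xs ++ (Ds ++ Ys)) := by
  have H : ∀ Es : List (List ℕ), (Xs ++ (Es ++ Ys)).Perm (Es ++ (Xs ++ Ys)) := fun Es => by
    rw [← List.append_assoc, ← List.append_assoc]
    exact List.perm_append_comm.append_right Ys
  exact (of_perm (H Cs)).trans ((h (Xs ++ Ys)).trans (of_perm (H Ds).symm))

end ChainConn

/-- A chain of `m` blocks of size two. -/
abbrev twoChain (m : ℕ) : List ℕ := List.replicate m 2

/-- A chain with `m` blocks of size two before its `3`-block and `l` after it. -/
abbrev threeChain (m l : ℕ) : List ℕ := List.replicate m 2 ++ 3 :: List.replicate l 2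

/-- Chains with a `3`-block, built from consecutive pairs of entries of a list. -/
def threeChains : List ℕ → List (List ℕ)
  | m :: l :: s => threeChain m l :: threeChains s
  | _ => []

namespace ChainConn

variable {A : Type*}

theorem four_exchange (m l : ℕ) (Xs : List (List ℕ)) :
    ChainConn A ((4 :: twoChain m) :: twoChain (l + 2) :: Xs)
      (twoChain (m + 2) :: (4 :: twoChain l) :: Xs) := by
  unfold ChainConn
  by_cases hX : Xs = []
  · subst hX
    simpa [List.intercalate_cons_cons, List.replicate_succ] using
      BlockConn.four_exchange (A := A) (twoChain m) (twoChain l)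
  · simpa [List.intercalate_cons_cons, List.intercalate_cons_of_ne_nil hX,
      List.replicate_succ] using
      BlockConn.four_exchange (A := A) (twoChain m) (twoChain l ++ 1 :: [1].intercalate Xs)

theorem three_reverse (m l : ℕ) (Xs : List (List ℕ)) :
    ChainConn A (threeChain m l :: Xs) (threeChain l m :: Xs) := by
  unfold ChainConn
  by_cases hX : Xs = []
  · subst hX
    match m, l with
    | m + 1, l => simpa using BlockConn.three_reverse (A := A) m l
    | 0, l + 1 => simpa [threeChain] using BlockConn.three_reverse_left (A := A) l
    | 0, 0 => exact BlockConn.refl _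
  · rw [List.intercalate_cons_of_ne_nil hX, List.intercalate_cons_of_ne_nil hX]
    match m, l with
    | m + 1, l => simpa using BlockConn.three_reverse_append (A := A) m l ([1].intercalate Xs)
    | 0, l + 1 => simpa [threeChain] using BlockConn.three_reverse_left_append (A := A) l ([1].intercalate Xs)
    | 0, 0 => exact BlockConn.refl _

theorem three_exchange (m k l r : ℕ) (Xs : List (List ℕ)) :
    ChainConn A (threeChain m k :: threeChain l r :: Xs)
      (threeChain m l :: threeChain k r :: Xs) := by
  unfold ChainConn
  by_cases hX : Xs = []
  · subst hX
    simpa [List.intercalate_cons_cons] using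
      BlockConn.three_exchange (A := A) k l (twoChain m) (twoChain r)
  · simpa [List.intercalate_cons_cons, List.intercalate_cons_of_ne_nil hX] using
      BlockConn.three_exchange (A := A) k l (twoChain m) (twoChain r ++ 1 :: [1].intercalate Xs)

/-- Adjacent entries are either the two ends of one chain, which reversal swaps, or the facing ends
of neighbouring chains, which `three_exchange` swaps; the parity of `X` decides. Complete chains
passed on the way are collected in `Fs`. -/
theorem threeChains_swap (a b : ℕ) (Es : List (List ℕ)) :
    ∀ (X Y : List ℕ) (Fs : List (List ℕ)), Even (X.length + Y.length) →
      ChainConn A (Fs ++ (threeChains (X ++ a :: b :: Y) ++ Es))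
        (Fs ++ (threeChains (X ++ b :: a :: Y) ++ Es))
  | [], Y, Fs, _ => by
    simpa [threeChains] using of_prefix (A := A) (Cs := [threeChain a b]) (Ds := [threeChain b a])
      (three_reverse a b) Fs (threeChains Y ++ Es)
  -- Excluded by parity; `threeChains` would drop the unpaired last entry.
  | [x], [], Fs, h => by simp at h
  | [x], y :: Y, Fs, _ => by
    simpa [threeChains] using of_prefix (A := A) (Cs := [threeChain x a, threeChain b y])
      (Ds := [threeChain x b, threeChain a y]) (three_exchange x a b y) Fs (threeChains Y ++ Es)
  | x :: x' :: X, Y, Fs, h => by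
    have h' : Even (X.length + Y.length) := by
      simp only [List.length_cons] at h
      grind
    simpa [threeChains] using threeChains_swap a b Es X Y (Fs ++ [threeChain x x']) h'

theorem threeChains_perm {s s' : List ℕ} (h : s.Perm s') (hs : Even s.length)
    (Es : List (List ℕ)) : ChainConn A (threeChains s ++ Es) (threeChains s' ++ Es) := by
  suffices H : ∀ X : List ℕ, Even (X.length + s.length) →
      ChainConn A (threeChains (X ++ s) ++ Es) (threeChains (X ++ s') ++ Es) from
    H [] (by simpa using hs)
  clear hs
  induction h with
  | nil => exact fun X _ => refl _
  | @cons a s₁ s₂ h ih =>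
    intro X hX
    have hX' : Even ((X ++ [a]).length + s₁.length) := by
      simp only [List.length_append, List.length_cons, List.length_nil] at hX ⊢
      grind
    simpa using ih (X ++ [a]) hX'
  | swap a b s =>
    intro X hX
    have hX' : Even (X.length + s.length) := by
      simp only [List.length_cons] at hX
      grind
    exact threeChains_swap b a Es X s [] hX'
  | trans h h' ih ih' => exact fun X hX => (ih X hX).trans (ih' X (h.length_eq ▸ hX))

end ChainConn

/-- The lengths of the cycles of `Y` for a piece-wise order reversing pair with the block sizes in
the list; the first argument counts the letters on the path that returns from the blocks further
left. -/
def blockCycles : ℕ → List ℕ → List ℕ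
  | d, [] => [1 + d]
  | d, s :: L =>
    if Even s then blockCycles (s + d) L else ((s + 1) / 2 + d) :: blockCycles ((s - 1) / 2) L

/-- A `1`-block closes the pending path and passes no letter on, so the chains contribute
independently. -/
theorem blockCycles_append_one (d : ℕ) (C L : List ℕ) :
    blockCycles d (C ++ 1 :: L) = blockCycles d C ++ blockCycles 0 L := by
  induction C generalizing d with
  | nil => simp [blockCycles]
  | cons s C ih => by_cases h : Even s <;> simp [blockCycles, h, ih]

theorem blockCycles_intercalate {Cs : List (List ℕ)} (hC : Cs ≠ []) :
    blockCycles 0 ([1].intercalate Cs) = Cs.flatMap (blockCycles 0) := by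
  induction Cs with
  | nil => exact absurd rfl hC
  | cons C Cs ih =>
    by_cases h : Cs = []
    · subst h; simp
    · rw [List.intercalate_cons_of_ne_nil h, List.append_assoc, List.singleton_append,
        blockCycles_append_one, ih h, List.flatMap_cons]

theorem blockCycles_twoChain_append (d m : ℕ) (L : List ℕ) :
    blockCycles d (twoChain m ++ L) = blockCycles (2 * m + d) L := by
  induction m generalizing d with
  | zero => simp
  | succ m ih =>
    simp only [twoChain, List.replicate_succ, List.cons_append, blockCycles, even_two, if_true]
    rw [ih]
    congr 1
    ring

theorem blockCycles_twoChain (d m : ℕ) : blockCycles d (twoChain m) = [1 + (2 * m + d)] := by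
  simpa [blockCycles] using blockCycles_twoChain_append d m []

theorem blockCycles_threeChain (m l : ℕ) :
    blockCycles 0 (threeChain m l) = [2 * m + 2, 2 * l + 2] := by
  rw [threeChain, blockCycles_twoChain_append]
  have h3 : ¬ Even 3 := by decide
  simp only [blockCycles, h3, if_false, blockCycles_twoChain]
  simp
  omega

theorem blockCycles_fourChain (m : ℕ) : blockCycles 0 (4 :: twoChain m) = [2 * m + 5] := by
  have h4 : Even 4 := by decide
  simp only [blockCycles, h4, if_true, blockCycles_twoChain]
  simp
  omega

theorem sum_intercalate {Cs : List (List ℕ)} (hC : Cs ≠ []) :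
    ([1].intercalate Cs).sum + 1 = Cs.length + Cs.flatten.sum := by
  induction Cs with
  | nil => exact absurd rfl hC
  | cons C Cs ih =>
    by_cases h : Cs = []
    · subst h; simp; omega
    · rw [List.intercalate_cons_of_ne_nil h]
      have := ih h
      simp at this ⊢
      omega

end RauzyPair

/-! ### Block sizes of the same Type with the same cycle lengths are connected -/

namespace RauzyPair

theorem intercalate_chains (L : List ℕ) : [1].intercalate (chains L) = L :=
  List.intercalate_splitOn 1

theorem chains_ne_nil (L : List ℕ) : chains L ≠ [] := by
  simp [chains, List.splitOn, List.splitOnP_ne_nil]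

theorem mem_of_mem_chains {L : List ℕ} : ∀ C ∈ chains L, ∀ s ∈ C, s ∈ L ∧ s ≠ 1 := by
  induction L with
  | nil => simp [chains]
  | cons x L ih =>
    have hx : chains (x :: L) =
        if x = 1 then [] :: chains L else (chains L).modifyHead (List.cons x) := by
      simp [chains, List.splitOn, List.splitOnP_cons_eq_if_modifyHead]
    rw [hx]
    match hL : chains L with
    | [] => exact absurd hL (chains_ne_nil L)
    | D :: Ds =>
      rw [hL] at ih
      split_ifs with h <;> intro C hC s hs <;> simp at hC ih <;> grind

theorem sum_chains (L : List ℕ) : L.sum + 1 = (chains L).length + (chains L).flatten.sum := by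
  rw [← sum_intercalate (chains_ne_nil L), intercalate_chains]

theorem blockCycles_perm {L : List ℕ} {Cs : List (List ℕ)} (h : (chains L).Perm Cs) :
    (blockCycles 0 L).Perm (Cs.flatMap (blockCycles 0)) := by
  conv_lhs => rw [← intercalate_chains L]
  rw [blockCycles_intercalate (chains_ne_nil L)]
  exact h.flatMap_right _

theorem blockConn_of_chains {A : Type*} {L L' : List ℕ} {Cs Cs' : List (List ℕ)}
    (h : (chains L).Perm Cs) (h' : (chains L').Perm Cs') (hC : ChainConn A Cs Cs') :
    BlockConn A L L' := by
  have := (ChainConn.of_perm h).trans (hC.trans (ChainConn.of_perm (A := A) h'.symm))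
  unfold ChainConn at this
  rwa [intercalate_chains, intercalate_chains] at this

theorem eq_twoChain {C : List ℕ} (h : ∀ s ∈ C, s = 2) : C = twoChain C.length :=
  List.eq_replicate_iff.2 ⟨rfl, h⟩

theorem eq_map_twoChain {Cs : List (List ℕ)} (h : ∀ C ∈ Cs, ∀ s ∈ C, s = 2) :
    Cs = (Cs.map List.length).map twoChain := by
  rw [List.map_map]
  conv_lhs => rw [← List.map_id Cs]
  exact List.map_congr_left fun C hC => eq_twoChain (h C hC)

theorem flatMap_map_twoChain (Ms : List ℕ) :
    (Ms.map twoChain).flatMap (blockCycles 0) = Ms.map (2 * · + 1) := by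
  induction Ms with
  | nil => rfl
  | cons m Ms ih => simp only [List.map_cons, List.flatMap_cons, ih, blockCycles_twoChain]; simp; omega

theorem flatMap_threeChains : ∀ {s : List ℕ}, Even s.length →
    (threeChains s).flatMap (blockCycles 0) = s.map (2 * · + 2)
  | [], _ => rfl
  | [_], h => by simp at h
  | m :: l :: s, h => by
    have h' : Even s.length := by simp only [List.length_cons] at h; grind
    simp [threeChains, blockCycles_threeChain, flatMap_threeChains h']

variable {A : Type*} {L L' : List ℕ}

/-- Since `m ↦ 2m+1` is injective, the cycle lengths give the chains up to order. -/
theorem Type2.blockConn (h : Type2 L) (h' : Type2 L')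
    (hP : (blockCycles 0 L).Perm (blockCycles 0 L')) : BlockConn A L L' := by
  have e := eq_map_twoChain h.2
  have e' := eq_map_twoChain h'.2
  have k := blockCycles_perm (List.Perm.of_eq e)
  have k' := blockCycles_perm (List.Perm.of_eq e')
  rw [flatMap_map_twoChain] at k k'
  have := (k.symm.trans hP).trans k'
  rw [List.map_perm_map_iff (fun a b h => by simpa using h)] at this
  exact blockConn_of_chains (List.Perm.of_eq e) (List.Perm.of_eq e')
    (ChainConn.of_perm (this.map _))

theorem Type5.exists_perm (h : Type5 L) :
    ∃ Ms : List ℕ, (chains L).Perm ([5] :: Ms.map twoChain) := by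
  obtain ⟨-, l, r, e, h⟩ := h
  refine ⟨(l ++ r).map List.length, ?_⟩
  rw [← eq_map_twoChain, e]
  · exact List.perm_middle
  · intro C hC s hs
    rw [h C hC (List.ne_nil_of_mem hs)] at hs
    simpa using hs

theorem Type4.exists_perm (h : Type4 L) :
    ∃ (m : ℕ) (Ms : List ℕ), (chains L).Perm ((4 :: twoChain m) :: Ms.map twoChain) := by
  obtain ⟨-, l, r, m, e, h⟩ := h
  refine ⟨m, (l ++ r).map List.length, ?_⟩
  rw [← eq_map_twoChain h, e]
  exact List.perm_middle

theorem Type5.blockConn (h : Type5 L) (h' : Type5 L')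
    (hP : (blockCycles 0 L).Perm (blockCycles 0 L')) : BlockConn A L L' := by
  obtain ⟨Ms, e⟩ := h.exists_perm
  obtain ⟨Ms', e'⟩ := h'.exists_perm
  have := ((blockCycles_perm e).symm.trans hP).trans (blockCycles_perm e')
  rw [List.flatMap_cons, List.flatMap_cons, List.perm_append_left_iff, flatMap_map_twoChain,
    flatMap_map_twoChain, List.map_perm_map_iff (fun a b h => by simpa using h)] at this
  exact blockConn_of_chains e e' (ChainConn.of_perm ((this.map _).cons _))

theorem Type4.blockConn (h : Type4 L) (h' : Type4 L')
    (hP : (blockCycles 0 L).Perm (blockCycles 0 L')) : BlockConn A L L' := by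
  obtain ⟨m, Ms, e⟩ := h.exists_perm
  obtain ⟨m', Ms', e'⟩ := h'.exists_perm
  have := ((blockCycles_perm e).symm.trans hP).trans (blockCycles_perm e')
  -- For cycle lengths, the chain of a `4`-block and `k` `2`-blocks looks like a chain of `k + 2`
  -- `2`-blocks.
  have key : ∀ (k : ℕ) (Ks : List ℕ),
      ((4 :: twoChain k) :: Ks.map twoChain).flatMap (blockCycles 0) =
        ((k + 2) :: Ks).map (2 * · + 1) := fun k Ks => by
    rw [List.flatMap_cons, flatMap_map_twoChain, blockCycles_fourChain]
    simp
    omega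
  rw [key, key, List.map_perm_map_iff (fun a b h => by simpa using h)] at this
  refine blockConn_of_chains e e' ?_
  by_cases hm : m = m'
  · subst hm
    exact ChainConn.of_perm (((List.perm_cons _).1 this |>.map _).cons _)
  -- The cycle of the other `4`-block must come from a chain of `m' + 2` `2`-blocks; that chain has
  -- the two `2`-blocks that `four_exchange` needs.
  · have h1 : m' + 2 ∈ Ms := by
      have : m' + 2 ∈ (m + 2) :: Ms := this.mem_iff.2 (by simp)
      simpa [Ne.symm hm] using this
    obtain ⟨Ks, hK⟩ : ∃ Ks, Ms.Perm ((m' + 2) :: Ks) := ⟨_, List.perm_cons_erase h1⟩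
    have h2 : Ms'.Perm ((m + 2) :: Ks) := by
      refine ((List.perm_cons (m' + 2)).1 ?_)
      exact this.symm.trans ((hK.cons _).trans (List.Perm.swap _ _ _))
    refine (ChainConn.of_perm ((hK.map twoChain).cons _)).trans ?_
    refine (ChainConn.four_exchange m m' (Ks.map twoChain)).trans ?_
    refine ChainConn.of_perm ((List.Perm.swap _ _ _).trans ((h2.symm.map twoChain).cons _))

theorem Type3.exists_perm (h : Type3 L) :
    ∃ s Ms : List ℕ, Even s.length ∧ (chains L).Perm (threeChains s ++ Ms.map twoChain) := by
  have H : ∀ C ∈ chains L, IsThreeChain C ∨ ∃ m : ℕ, C = List.replicate m 2 := fun C hC => by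
    by_cases hn : C = []
    · exact Or.inr ⟨0, hn⟩
    · exact (h.2.1 C hC hn).imp id fun ⟨m, _, hm⟩ => ⟨m, hm⟩
  generalize chains L = Cs at H
  induction Cs with
  | nil => exact ⟨[], [], by simp, by simp [threeChains]⟩
  | cons C Cs ih =>
    obtain ⟨s, Ms, hs, hp⟩ := ih fun D hD => H D (List.mem_cons_of_mem _ hD)
    rcases H C List.mem_cons_self with ⟨m, l, rfl⟩ | ⟨m, rfl⟩
    · exact ⟨m :: l :: s, Ms, by simp only [List.length_cons]; grind,
        hp.cons (threeChain m l)⟩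
    · exact ⟨s, m :: Ms, hs, (hp.cons _).trans (by simpa using List.perm_middle.symm)⟩

/-- Parity separates the contributions: even lengths come from the chains with a `3`-block, odd ones
from the chains of `2`-blocks. -/
theorem Type3.blockConn (h : Type3 L) (h' : Type3 L')
    (hP : (blockCycles 0 L).Perm (blockCycles 0 L')) : BlockConn A L L' := by
  obtain ⟨s, Ms, hs, e⟩ := h.exists_perm
  obtain ⟨s', Ms', hs', e'⟩ := h'.exists_perm
  have := ((blockCycles_perm e).symm.trans hP).trans (blockCycles_perm e')
  rw [List.flatMap_append, List.flatMap_append, flatMap_map_twoChain, flatMap_map_twoChain,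
    flatMap_threeChains hs, flatMap_threeChains hs'] at this
  have hE : ∀ u : List ℕ, (u.map (2 * · + 2)).filter (fun x => decide (Even x)) =
      u.map (2 * · + 2) := fun u => by
    rw [List.filter_eq_self]
    intro a ha
    obtain ⟨x, -, rfl⟩ := List.mem_map.1 ha
    simp only [decide_eq_true_eq]
    grind
  have hO : ∀ u : List ℕ, (u.map (2 * · + 1)).filter (fun x => decide (Even x)) = [] :=
    fun u => by
    rw [List.filter_eq_nil_iff]
    intro a ha
    obtain ⟨x, -, rfl⟩ := List.mem_map.1 ha
    simp only [decide_eq_true_eq]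
    grind
  have h1 := this.filter (fun x => decide (Even x))
  rw [List.filter_append, List.filter_append, hE, hE, hO, hO, List.append_nil,
    List.append_nil] at h1
  have h2 := (List.perm_append_left_iff _).1 (this.trans (h1.symm.append_right _))
  rw [List.map_perm_map_iff (fun a b h => by simpa using h)] at h1 h2
  refine blockConn_of_chains e e' ((ChainConn.threeChains_perm h1 hs _).trans ?_)
  exact ChainConn.of_perm ((h2.map _).append_left _)

theorem Type1.exists_perm (h : Type1 L) (hL : ∀ s ∈ L, 0 < s) :
    (∃ k, (chains L).Perm (List.replicate (k + 1) [])) ∨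
      ∃ s k, 2 ≤ s ∧ (chains L).Perm ([s] :: List.replicate k []) := by
  have hp := (List.filter_append_perm (fun C : List ℕ => decide (C ≠ [])) (chains L)).symm
  obtain ⟨k, hk⟩ : ∃ k, (chains L).filter (fun C => !decide (C ≠ [])) = List.replicate k [] :=
    ⟨_, List.eq_replicate_iff.2 ⟨rfl, fun C hC => by simpa using (List.mem_filter.1 hC).2⟩⟩
  rw [hk] at hp
  have h1 := h.1
  match hF : (chains L).filter (fun C => decide (C ≠ [])) with
  | [] =>
    rw [hF] at hp
    match k with
    | 0 => exact absurd hp.eq_nil (chains_ne_nil L)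
    | k + 1 => exact Or.inl ⟨k, by simpa using hp⟩
  | [C] =>
    rw [hF] at hp
    have hC : C ∈ (chains L).filter (fun C => decide (C ≠ [])) := hF ▸ List.mem_singleton_self C
    rw [List.mem_filter] at hC
    obtain ⟨s, rfl⟩ := List.length_eq_one_iff.1 (h.2 C hC.1 (by simpa using hC.2))
    refine Or.inr ⟨s, k, ?_, by simpa using hp⟩
    have hs1 := mem_of_mem_chains _ hC.1 s (List.mem_singleton_self s)
    have hs0 := hL s hs1.1
    omega
  | C :: D :: Es => rw [hF] at h1; simp at h1

/-- A block of size at least `2` gives a cycle longer than `1`, so such a block is present on both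
sides or on neither. The sum of the sizes and the number of cycles then determine the size and the
number of empty chains, once the parities are known to agree. -/
theorem Type1.blockConn (h : Type1 L) (h' : Type1 L') (hL : ∀ s ∈ L, 0 < s)
    (hL' : ∀ s ∈ L', 0 < s) (hs : L.sum = L'.sum)
    (hP : (blockCycles 0 L).Perm (blockCycles 0 L')) : BlockConn A L L' := by
  have hn : ∀ k, (List.replicate k ([] : List ℕ)).flatMap (blockCycles 0) =
      List.replicate k 1 := fun k => by
    induction k with
    | zero => rfl
    | succ k ih => simp [List.replicate_succ, ih, blockCycles]
  have hd : ∀ s, (Even s ∧ blockCycles 0 [s] = [1 + s]) ∨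
      (¬ Even s ∧ blockCycles 0 [s] = [(s + 1) / 2, 1 + (s - 1) / 2]) := fun s => by
    by_cases h : Even s <;> simp [blockCycles, h]
  have hg : ∀ s, 2 ≤ s → ∃ x ∈ blockCycles 0 [s], x ≠ 1 := fun s h2 => by
    rcases hd s with ⟨h, e⟩ | ⟨h, e⟩ <;> rw [e]
    · exact ⟨_, List.mem_cons_self, by omega⟩
    · have : s ≠ 2 := by rintro rfl; exact h even_two
      exact ⟨_, List.mem_cons_self, by omega⟩
  have hsum := sum_chains L
  have hsum' := sum_chains L'
  rcases h.exists_perm hL with ⟨k, e⟩ | ⟨s, k, hs2, e⟩ <;>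
    rcases h'.exists_perm hL' with ⟨k', e'⟩ | ⟨s', k', hs2', e'⟩ <;>
    rw [e.length_eq, e.flatten.sum_eq] at hsum <;>
    rw [e'.length_eq, e'.flatten.sum_eq] at hsum' <;>
    have hp := ((blockCycles_perm e).symm.trans hP).trans (blockCycles_perm e')
  · simp at hsum hsum'
    obtain rfl : k = k' := by omega
    exact blockConn_of_chains e e' (ChainConn.refl _)
  · rw [List.flatMap_cons, hn, hn] at hp
    obtain ⟨x, hx, hx1⟩ := hg s' hs2'
    have := List.eq_of_mem_replicate (hp.mem_iff.2 (List.mem_append_left _ hx))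
    omega
  · rw [List.flatMap_cons, hn, hn] at hp
    obtain ⟨x, hx, hx1⟩ := hg s hs2
    have := List.eq_of_mem_replicate (hp.mem_iff.1 (List.mem_append_left _ hx))
    omega
  · rw [List.flatMap_cons, List.flatMap_cons, hn, hn] at hp
    have hl := hp.length_eq
    simp at hsum hsum'
    have hss : s = s' := by
      rcases hd s with ⟨h1, h2⟩ | ⟨h1, h2⟩ <;> rcases hd s' with ⟨h3, h4⟩ | ⟨h3, h4⟩ <;>
        rw [h2, h4] at hp hl <;> simp at hl <;> try omega
      -- For `s` even and `s'` odd the counts force `s' = s + 1`, and then no cycle on the other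
      -- side is as long as `1 + s`.
      · have : 1 + s ∈ [(s' + 1) / 2, 1 + (s' - 1) / 2] ++ List.replicate k' 1 :=
          hp.mem_iff.1 (by simp)
        simp at this
        omega
      · have : 1 + s' ∈ [(s + 1) / 2, 1 + (s - 1) / 2] ++ List.replicate k 1 :=
          hp.mem_iff.2 (by simp)
        simp at this
        omega
    subst hss
    obtain rfl : k = k' := by omega
    exact blockConn_of_chains e e' (ChainConn.refl _)

/-- Two lists of block sizes of the same type, with the same sum and the same list of cycle
lengths, are connected. -/
theorem BlocksOfType.blockConn {x : TypeLabel} (h : BlocksOfType x L) (h' : BlocksOfType x L')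
    (hL : ∀ s ∈ L, 0 < s) (hL' : ∀ s ∈ L', 0 < s) (hs : L.sum = L'.sum)
    (hP : (blockCycles 0 L).Perm (blockCycles 0 L')) : BlockConn A L L' := by
  cases x with
  | one => exact Type1.blockConn h h' hL hL' hs hP
  | two => exact Type2.blockConn h h' hP
  | three => exact Type3.blockConn h h' hP
  | four => exact Type4.blockConn h h' hP
  | five => exact Type5.blockConn h h' hP

end RauzyPair

/-! ### Dictionary between pairs and words -/

namespace RauzyPair

variable {A : Type*} [Fintype A]

/-- The letters of the row `ε`, from left to right. -/
def rowWord (p : RauzyPair A) (ε : Fin 2) : List A := List.ofFn (p.row ε).symm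

/-- Both rows. -/
def words (p : RauzyPair A) : List A × List A := (p.rowWord 0, p.rowWord 1)

@[simp] theorem length_rowWord (p : RauzyPair A) (ε : Fin 2) :
    (p.rowWord ε).length = Fintype.card A := by simp [rowWord]

theorem nodup_rowWord (p : RauzyPair A) (ε : Fin 2) : (p.rowWord ε).Nodup :=
  List.nodup_ofFn.2 (p.row ε).symm.injective

theorem mem_rowWord (p : RauzyPair A) (ε : Fin 2) (b : A) : b ∈ p.rowWord ε :=
  (List.mem_ofFn' _ _).2 ((p.row ε).symm.surjective b)

theorem pos_eq_idxOf [DecidableEq A] (p : RauzyPair A) (ε : Fin 2) (b : A) :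
    p.pos ε b = (p.rowWord ε).idxOf b + 1 := by
  have h : (p.row ε b : ℕ) < (p.rowWord ε).length := by simp
  have hb : (p.rowWord ε)[(p.row ε b : ℕ)] = b := by simp [rowWord]
  have := (p.nodup_rowWord ε).idxOf_getElem _ h
  rw [hb] at this
  rw [this, pos]

theorem words_injective : Function.Injective (words (A := A)) := by
  intro p q h
  have h0 : p.rowWord 0 = q.rowWord 0 := congrArg Prod.fst h
  have h1 : p.rowWord 1 = q.rowWord 1 := congrArg Prod.snd h
  have e0 := List.ofFn_injective h0
  have e1 := List.ofFn_injective h1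
  obtain ⟨p⟩ := p
  obtain ⟨q⟩ := q
  congr 1
  funext ε
  apply Equiv.symm_bijective.injective
  apply Equiv.coe_fn_injective
  fin_cases ε
  · exact e0
  · exact e1

theorem exists_rowWord_eq {l : List A} (hl : l.Nodup) (h : ∀ b, b ∈ l) :
    ∃ e : A ≃ Fin (Fintype.card A), List.ofFn e.symm = l := by
  classical
  have hc : l.length = Fintype.card A := by
    rw [← List.toFinset_card_of_nodup hl, ← Finset.card_univ]
    congr 1
    ext b
    simp [h b]
  refine ⟨((finCongr hc).symm.trans (hl.getEquivOfForallMemList l h)).symm, ?_⟩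
  apply List.ext_getElem
  · simp [hc]
  · intro i h1 h2
    simp

/-- A word pair that comes from an irreducible pair. -/
structure WordGood {A : Type*} (u : List A × List A) : Prop where
  nodup_fst : u.1.Nodup
  nodup_snd : u.2.Nodup
  mem_fst : ∀ b, b ∈ u.1
  mem_snd : ∀ b, b ∈ u.2
  irreducible : ∀ k, 0 < k → k < u.1.length → ¬ ∀ b, b ∈ u.1.take k ↔ b ∈ u.2.take k

theorem mem_take_rowWord (p : RauzyPair A) (ε : Fin 2) (b : A) (k : ℕ) :
    b ∈ (p.rowWord ε).take k ↔ p.pos ε b ≤ k := by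
  classical
  rw [pos_eq_idxOf, List.mem_take_iff_idxOf_lt (p.mem_rowWord ε b)]
  omega

theorem wordGood_words {p : RauzyPair A} (hp : p.IsIrreducible) : WordGood p.words where
  nodup_fst := p.nodup_rowWord 0
  nodup_snd := p.nodup_rowWord 1
  mem_fst := p.mem_rowWord 0
  mem_snd := p.mem_rowWord 1
  irreducible k hk hk' H := by
    simp only [words, length_rowWord, mem_take_rowWord] at hk' H
    have := (hp k hk hk'.le).1 (Set.ext H)
    omega

theorem WordGood.exists_pair {u : List A × List A} (hu : WordGood u) :
    ∃ p : RauzyPair A, p.words = u := by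
  obtain ⟨e, he⟩ := exists_rowWord_eq hu.nodup_fst hu.mem_fst
  obtain ⟨f, hf⟩ := exists_rowWord_eq hu.nodup_snd hu.mem_snd
  exact ⟨⟨![e, f]⟩, Prod.ext he hf⟩

theorem WordGood.isIrreducible {p : RauzyPair A} (h : WordGood p.words) : p.IsIrreducible := by
  intro k hk hk'
  constructor
  · intro H
    by_contra hne
    refine h.irreducible k hk (by simp only [words, length_rowWord]; omega) fun b => ?_
    simp only [words, mem_take_rowWord]
    exact Set.ext_iff.1 H b
  · rintro rfl
    ext b
    have h0 := (p.row 0 b).isLt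
    have h1 := (p.row 1 b).isLt
    simp only [pos, Set.mem_ofPred_eq]
    omega

theorem isRauzyMove_of_rowWord {ε : Fin 2} {p p' : RauzyPair A} {X Y Z : List A} {z w : A}
    (h : p.rowWord ε = X ++ [z]) (h' : p'.rowWord ε = X ++ [z])
    (k : p.rowWord (1 - ε) = Y ++ z :: (Z ++ [w])) (k' : p'.rowWord (1 - ε) = Y ++ z :: w :: Z) :
    IsRauzyMove ε p p' := by
  classical
  constructor
  · apply Equiv.symm_bijective.injective
    exact Equiv.coe_fn_injective (List.ofFn_injective (h'.trans h.symm))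
  intro z' hz' b
  have hn := p.nodup_rowWord (1 - ε)
  have hX := p.nodup_rowWord ε
  have hb := p.mem_rowWord (1 - ε) b
  have hc := p.length_rowWord (1 - ε)
  have hcX := p.length_rowWord ε
  rw [pos_eq_idxOf] at hz'
  have hzz : z' = z := by
    have hz := p.mem_rowWord ε z'
    rw [h] at hz hz' hX hcX
    rw [List.mem_append, List.mem_singleton] at hz
    rcases hz with hz | hz
    · rw [List.idxOf_append_of_mem hz] at hz'
      have := List.idxOf_lt_length_of_mem hz
      simp at hcX
      omega
    · exact hz
  subst hzz
  simp only [pos_eq_idxOf, k, k'] at *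
  rw [List.nodup_append, List.nodup_cons, List.nodup_append] at hn
  simp only [List.length_append, List.length_cons, List.length_nil] at hc
  have hzY : z' ∉ Y := fun hm => hn.2.2 _ hm _ List.mem_cons_self rfl
  rw [List.idxOf_append_of_notMem hzY, List.idxOf_cons_self]
  simp only [List.mem_append, List.mem_cons, List.not_mem_nil, or_false] at hb
  by_cases hbY : b ∈ Y
  · have := List.idxOf_lt_length_of_mem hbY
    rw [List.idxOf_append_of_mem hbY, List.idxOf_append_of_mem hbY, if_pos (by omega)]
  rw [List.idxOf_append_of_notMem hbY, List.idxOf_append_of_notMem hbY]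
  by_cases hbz : b = z'
  · subst hbz
    simp
  rw [List.idxOf_cons_ne _ (Ne.symm hbz), List.idxOf_cons_ne _ (Ne.symm hbz)]
  by_cases hbZ : b ∈ Z
  · have hbw : b ≠ w := fun e => hn.2.1.2.2.2 _ hbZ _ (List.mem_singleton_self w) e
    have := List.idxOf_lt_length_of_mem hbZ
    rw [List.idxOf_cons_ne _ (Ne.symm hbw), List.idxOf_append_of_mem hbZ, if_neg (by omega),
      if_pos (by omega)]
    omega
  · obtain rfl : b = w := by tauto
    rw [List.idxOf_cons_self, List.idxOf_append_of_notMem hbZ, List.idxOf_cons_self,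
      if_neg (by omega), if_neg (by omega)]

theorem isLeftRauzyMove_of_rowWord {ε : Fin 2} {p p' : RauzyPair A} {X Y Z : List A} {z w : A}
    (h : p.rowWord ε = z :: X) (h' : p'.rowWord ε = z :: X)
    (k : p.rowWord (1 - ε) = w :: (Z ++ z :: Y)) (k' : p'.rowWord (1 - ε) = Z ++ w :: z :: Y) :
    IsLeftRauzyMove ε p p' := by
  classical
  constructor
  · apply Equiv.symm_bijective.injective
    exact Equiv.coe_fn_injective (List.ofFn_injective (h'.trans h.symm))
  intro z' hz' b
  have hn := p.nodup_rowWord (1 - ε)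
  have hb := p.mem_rowWord (1 - ε) b
  rw [pos_eq_idxOf] at hz'
  have hzz : z' = z := by
    rw [h] at hz'
    by_contra hne
    rw [List.idxOf_cons_ne _ (Ne.symm hne)] at hz'
    omega
  subst hzz
  simp only [pos_eq_idxOf, k, k'] at *
  rw [List.nodup_cons, List.nodup_append, List.nodup_cons] at hn
  simp only [List.mem_append, List.mem_cons, not_or] at hn hb
  have hzZ : z' ∉ Z := fun hm => hn.2.2.2 _ hm _ (Or.inl rfl) rfl
  rw [List.idxOf_cons_ne _ hn.1.2.1, List.idxOf_append_of_notMem hzZ, List.idxOf_cons_self]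
  by_cases hbw : b = w
  · subst hbw
    rw [List.idxOf_append_of_notMem hn.1.1, List.idxOf_cons_self, List.idxOf_cons_self]
    simp
  rw [List.idxOf_cons_ne _ (Ne.symm hbw)]
  by_cases hbZ : b ∈ Z
  · have := List.idxOf_lt_length_of_mem hbZ
    rw [List.idxOf_append_of_mem hbZ, List.idxOf_append_of_mem hbZ, if_neg (by omega),
      if_pos (by omega)]
    omega
  · rw [List.idxOf_append_of_notMem hbZ, List.idxOf_append_of_notMem hbZ,
      List.idxOf_cons_ne _ (Ne.symm hbw), if_neg (by omega), if_neg (by omega)]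
    omega

section Good

variable {A : Type*} {u v : List A × List A}

theorem WordStep.perm_fst (h : WordStep u v) : u.1.Perm v.1 := by
  cases h with
  | rightZero => exact .refl _
  | rightOne X Y Z z w =>
    exact ((List.perm_append_singleton w Z).cons z).append_left Y
  | leftZero => exact .refl _
  | leftOne X Y Z z w => exact List.perm_middle.symm

theorem WordStep.perm_snd (h : WordStep u v) : u.2.Perm v.2 := by
  cases h with
  | rightZero X Y Z z w =>
    exact ((List.perm_append_singleton w Z).cons z).append_left Y
  | rightOne => exact .refl _
  | leftZero X Y Z z w => exact List.perm_middle.symm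
  | leftOne => exact .refl _

/-- If the prefixes of length `k` have the same letters, the final letter `z` of one row lies in
neither. So `k ≤ Y.length`, and the part of the other row changed by a right move is not reached. -/
theorem take_iff_right {X Y V V' : List A} {z : A} (hn : (X ++ [z]).Nodup) {k : ℕ}
    (hk : k < (X ++ [z]).length) :
    (∀ b, b ∈ (X ++ [z]).take k ↔ b ∈ (Y ++ z :: V).take k) →
      ∀ b, b ∈ (X ++ [z]).take k ↔ b ∈ (Y ++ z :: V').take k := by
  intro H
  have hz : z ∉ (X ++ [z]).take k := by
    rw [List.take_append_of_le_length (by simpa [Nat.lt_succ_iff] using hk)]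
    intro hm
    rw [List.nodup_append] at hn
    exact hn.2.2 _ (List.mem_of_mem_take hm) _ (List.mem_singleton_self z) rfl
  have hkY : k ≤ Y.length := by
    by_contra hlt
    apply hz
    rw [H, List.take_append]
    refine List.mem_append_right _ ?_
    obtain ⟨m, hm⟩ : ∃ m, k - Y.length = m + 1 := ⟨k - Y.length - 1, by omega⟩
    simp [hm]
  rw [List.take_append_of_le_length hkY] at H ⊢
  exact H

/-- Here `z` lies in both prefixes, so the prefix contains all of `V`, which a left move only
permutes. -/
theorem take_iff_left {X Y V V' : List A} {z : A} (hV : V.Perm V')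
    (hn : (V ++ z :: Y).Nodup) {k : ℕ} (hk : 0 < k) :
    (∀ b, b ∈ (z :: X).take k ↔ b ∈ (V ++ z :: Y).take k) →
      ∀ b, b ∈ (z :: X).take k ↔ b ∈ (V' ++ z :: Y).take k := by
  intro H
  have hz : z ∈ (V ++ z :: Y).take k := by
    rw [← H]
    obtain ⟨m, rfl⟩ : ∃ m, k = m + 1 := ⟨k - 1, by omega⟩
    simp
  have hkV : V.length ≤ k := by
    by_contra hlt
    rw [List.take_append_of_le_length (by omega)] at hz
    rw [List.nodup_append] at hn
    exact hn.2.2 _ (List.mem_of_mem_take hz) _ List.mem_cons_self rfl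
  intro b
  rw [H, List.take_append, List.take_append, List.take_of_length_le (l := V) hkV,
    List.take_of_length_le (l := V') (hV.length_eq ▸ hkV), hV.length_eq, List.mem_append, List.mem_append,
    hV.mem_iff]

theorem WordStep.irreducible_iff (h : WordStep u v) (h1 : u.1.Nodup) (h2 : u.2.Nodup)
    (h3 : u.1.length = u.2.length) :
    (∀ k, 0 < k → k < u.1.length → ¬ ∀ b, b ∈ u.1.take k ↔ b ∈ u.2.take k) ↔
      ∀ k, 0 < k → k < v.1.length → ¬ ∀ b, b ∈ v.1.take k ↔ b ∈ v.2.take k := by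
  have h1' := h.perm_fst.nodup_iff.1 h1
  have h2' := h.perm_snd.nodup_iff.1 h2
  have hl := h.perm_fst.length_eq
  rw [← hl]
  cases h with
  | rightZero X Y Z z w =>
    refine forall_congr' fun k => forall_congr' fun hk => forall_congr' fun hk' => not_congr ?_
    exact ⟨take_iff_right h1 hk', take_iff_right h1 hk'⟩
  | rightOne X Y Z z w =>
    refine forall_congr' fun k => forall_congr' fun hk => forall_congr' fun hk' => not_congr ?_
    have hk'' := h3 ▸ hk'
    exact ⟨fun H b => (take_iff_right h2 hk'' (fun b => (H b).symm) b).symm,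
      fun H b => (take_iff_right h2 hk'' (fun b => (H b).symm) b).symm⟩
  | leftZero X Y Z z w =>
    refine forall_congr' fun k => forall_congr' fun hk => forall_congr' fun hk' => not_congr ?_
    have hp : (w :: Z).Perm (Z ++ [w]) := (List.perm_append_singleton w Z).symm
    have a1 := take_iff_left (X := X) (Y := Y) (z := z) hp h2 hk
    have a2 := take_iff_left (X := X) (Y := Y) (z := z) hp.symm (by simpa using h2') hk
    simp only [List.append_assoc, List.cons_append, List.nil_append] at a1 a2
    exact ⟨a1, a2⟩
  | leftOne X Y Z z w =>
    refine forall_congr' fun k => forall_congr' fun hk => forall_congr' fun hk' => not_congr ?_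
    have hp : (w :: Z).Perm (Z ++ [w]) := (List.perm_append_singleton w Z).symm
    have a1 := take_iff_left (X := X) (Y := Y) (z := z) hp h1 hk
    have a2 := take_iff_left (X := X) (Y := Y) (z := z) hp.symm (by simpa using h1') hk
    simp only [List.append_assoc, List.cons_append, List.nil_append] at a1 a2
    exact ⟨fun H b => (a1 (fun b => (H b).symm) b).symm,
      fun H b => (a2 (fun b => (H b).symm) b).symm⟩

theorem WordStep.good_iff (h : WordStep u v) : WordGood u ↔ WordGood v := by
  have hf := h.perm_fst
  have hs := h.perm_snd
  constructor
  · intro g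
    have hp : u.1.Perm u.2 := (List.perm_ext_iff_of_nodup g.nodup_fst g.nodup_snd).2
      fun b => ⟨fun _ => g.mem_snd b, fun _ => g.mem_fst b⟩
    exact ⟨hf.nodup_iff.1 g.nodup_fst, hs.nodup_iff.1 g.nodup_snd,
      fun b => hf.mem_iff.1 (g.mem_fst b), fun b => hs.mem_iff.1 (g.mem_snd b),
      (h.irreducible_iff g.nodup_fst g.nodup_snd hp.length_eq).1 g.irreducible⟩
  · intro g
    have hp : v.1.Perm v.2 := (List.perm_ext_iff_of_nodup g.nodup_fst g.nodup_snd).2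
      fun b => ⟨fun _ => g.mem_snd b, fun _ => g.mem_fst b⟩
    have n1 := hf.nodup_iff.2 g.nodup_fst
    have n2 := hs.nodup_iff.2 g.nodup_snd
    exact ⟨n1, n2, fun b => hf.mem_iff.2 (g.mem_fst b), fun b => hs.mem_iff.2 (g.mem_snd b),
      (h.irreducible_iff n1 n2 (hf.length_eq.trans (hp.length_eq.trans hs.length_eq.symm))).2
        g.irreducible⟩

end Good

theorem WordStep.extStep {p p' : RauzyPair A} (hp : p.IsIrreducible) (hp' : p'.IsIrreducible)
    {u v : List A × List A} (h : WordStep u v) (hu : p.words = u) (hv : p'.words = v) :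
    ExtStep p p' := by
  refine ⟨hp, hp', ?_⟩
  cases h with
  | rightZero X Y Z z w =>
    exact ⟨0, .inl (isRauzyMove_of_rowWord (congrArg Prod.fst hu) (congrArg Prod.fst hv)
      (congrArg Prod.snd hu) (congrArg Prod.snd hv))⟩
  | rightOne X Y Z z w =>
    exact ⟨1, .inl (isRauzyMove_of_rowWord (congrArg Prod.snd hu) (congrArg Prod.snd hv)
      (congrArg Prod.fst hu) (congrArg Prod.fst hv))⟩
  | leftZero X Y Z z w =>
    exact ⟨0, .inr (isLeftRauzyMove_of_rowWord (congrArg Prod.fst hu) (congrArg Prod.fst hv)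
      (congrArg Prod.snd hu) (congrArg Prod.snd hv))⟩
  | leftOne X Y Z z w =>
    exact ⟨1, .inr (isLeftRauzyMove_of_rowWord (congrArg Prod.snd hu) (congrArg Prod.snd hv)
      (congrArg Prod.fst hu) (congrArg Prod.fst hv))⟩

/-- `ExtStep` asks for irreducible pairs, so the intermediate words of a connection have to come
from such pairs. `WordGood` is what makes them do so, and it passes along moves in both directions.
-/
theorem WordConn.eqvGen_extStep {u v : List A × List A} (h : WordConn u v) :
    (WordGood u ↔ WordGood v) ∧ ∀ p p' : RauzyPair A, WordGood u → p.words = u → p'.words = v →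
      Relation.EqvGen ExtStep p p' := by
  induction h with
  | rel u v h =>
    refine ⟨h.good_iff, ?_⟩
    rintro p p' hg rfl rfl
    exact .rel _ _ (h.extStep hg.isIrreducible (h.good_iff.1 hg).isIrreducible rfl rfl)
  | refl u =>
    refine ⟨Iff.rfl, ?_⟩
    rintro p p' - rfl hp'
    rw [words_injective hp']
    exact .refl _
  | symm u v h ih =>
    exact ⟨ih.1.symm, fun p p' hg hp hp' => (ih.2 p' p (ih.1.2 hg) hp' hp).symm⟩
  | trans u v w h h' ih ih' =>
    refine ⟨ih.1.trans ih'.1, fun p p' hg hp hp' => ?_⟩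
    obtain ⟨q, hq⟩ := (ih.1.1 hg).exists_pair
    exact (ih.2 p q hg hp hq).trans _ _ _ (ih'.2 q p' (ih.1.1 hg) hq hp')

theorem extClassNonLabeled_eq_of_eqvGen {p p' : RauzyPair A} (h : Relation.EqvGen ExtStep p p') :
    p.extClassNonLabeled = p'.extClassNonLabeled := by
  have : p.extClass = p'.extClass := Set.ext fun q =>
    ⟨fun hq => .trans _ _ _ (.symm _ _ h) hq, fun hq => .trans _ _ _ h hq⟩
  rw [extClassNonLabeled, this, extClassNonLabeled]

/-- The pair obtained by renaming the letters. -/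
def rename (σ : Equiv.Perm A) (p : RauzyPair A) : RauzyPair A := ⟨fun ε => σ.symm.trans (p.row ε)⟩

theorem toPerm_rename (σ : Equiv.Perm A) (p : RauzyPair A) : (p.rename σ).toPerm = p.toPerm := by
  ext i
  simp [toPerm, rename]

theorem pos_rename (σ : Equiv.Perm A) (p : RauzyPair A) (ε : Fin 2) (b : A) :
    (p.rename σ).pos ε b = p.pos ε (σ.symm b) := rfl

theorem IsIrreducible.rename {p : RauzyPair A} (hp : p.IsIrreducible) (σ : Equiv.Perm A) :
    (p.rename σ).IsIrreducible := by
  intro k h1 h2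
  rw [← hp k h1 h2]
  simp only [pos_rename, Set.ext_iff, Set.mem_ofPred_eq]
  exact ⟨fun H b => by simpa using H (σ b), fun H b => H (σ.symm b)⟩

theorem ExtStep.rename {p p' : RauzyPair A} (h : ExtStep p p') (σ : Equiv.Perm A) :
    ExtStep (p.rename σ) (p'.rename σ) := by
  obtain ⟨h1, h2, ε, h3⟩ := h
  refine ⟨h1.rename σ, h2.rename σ, ε, ?_⟩
  refine h3.imp (fun h => ⟨?_, ?_⟩) (fun h => ⟨?_, ?_⟩)
  · simp [RauzyPair.rename, h.1]
  · intro z hz b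
    exact h.2 (σ.symm z) hz (σ.symm b)
  · simp [RauzyPair.rename, h.1]
  · intro z hz b
    exact h.2 (σ.symm z) hz (σ.symm b)

/-- The moves commute with renaming, and `toPerm` forgets the names. -/
theorem extClassNonLabeled_subset_rename (σ : Equiv.Perm A) (p : RauzyPair A) :
    p.extClassNonLabeled ⊆ (p.rename σ).extClassNonLabeled := by
  rintro _ ⟨q, hq, rfl⟩
  refine ⟨q.rename σ, ?_, toPerm_rename σ q⟩
  change Relation.EqvGen ExtStep p q at hq
  change Relation.EqvGen ExtStep _ _
  induction hq with
  | rel p q h => exact .rel _ _ (h.rename σ)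
  | refl p => exact .refl _
  | symm p q _ ih => exact ih.symm
  | trans p q r _ _ ih ih' => exact ih.trans _ _ _ ih'

theorem extClassNonLabeled_rename (σ : Equiv.Perm A) (p : RauzyPair A) :
    (p.rename σ).extClassNonLabeled = p.extClassNonLabeled := by
  refine (Set.Subset.antisymm (extClassNonLabeled_subset_rename σ p) ?_).symm
  have := extClassNonLabeled_subset_rename σ.symm (p.rename σ)
  have e : (p.rename σ).rename σ.symm = p := by
    obtain ⟨r⟩ := p
    simp only [rename]
    congr 1
    funext ε
    ext b
    simp
  rwa [e] at this

theorem rowWord_rename (σ : Equiv.Perm A) (p : RauzyPair A) (ε : Fin 2) :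
    (p.rename σ).rowWord ε = (p.rowWord ε).map σ := by
  simp only [rowWord, rename, List.map_ofFn]
  rfl

end RauzyPair

/-! ### Invariance of `P` under the moves -/

namespace RauzyPair

variable {A : Type*} [Fintype A]

theorem one_le_pos (p : RauzyPair A) (ε : Fin 2) (b : A) : 1 ≤ p.pos ε b := Nat.le_add_left _ _

theorem pos_le_card (p : RauzyPair A) (ε : Fin 2) (b : A) : p.pos ε b ≤ Fintype.card A :=
  (p.row ε b).isLt

theorem pos_injective (p : RauzyPair A) (ε : Fin 2) : Function.Injective (p.pos ε) := by
  intro a b h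
  simp only [pos, add_left_inj] at h
  exact (p.row ε).injective (Fin.ext h)

theorem exists_pos_eq (p : RauzyPair A) (ε : Fin 2) {k : ℕ} (h1 : 1 ≤ k)
    (hk : k ≤ Fintype.card A) : ∃ b, p.pos ε b = k := by
  have : Nonempty A := Fintype.card_pos_iff.1 (by omega)
  exact ⟨_, p.pos_letter ε k h1 hk⟩

/-- `β` follows `γ` in the first row, where the last letter of that row is followed by the letter
that follows the last letter of the second row. -/
def Follows (p : RauzyPair A) (γ β : A) : Prop :=
  p.pos 0 β = p.pos 0 γ + 1 ∨
    (p.pos 0 γ = Fintype.card A ∧ ∃ δ, p.pos 1 δ = Fintype.card A ∧ p.pos 0 β = p.pos 0 δ + 1)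

/-- The graph of `S`. -/
def SGraph (p : RauzyPair A) (α β : A) : Prop :=
  (p.pos 1 α = 1 ∧ p.pos 0 β = 1) ∨ ∃ γ, p.pos 1 α = p.pos 1 γ + 1 ∧ p.Follows γ β

/-- The graph of `Y`. -/
def YGraph (p : RauzyPair A) (α β : A) : Prop :=
  if p.pos 1 α = 1 then ∃ γ, p.SGraph α γ ∧ p.SGraph γ β else p.SGraph α β

theorem Follows.unique {p : RauzyPair A} {γ β β' : A} (h : p.Follows γ β) (h' : p.Follows γ β') : β = β' := by
  apply p.pos_injective 0
  have hβ := p.pos_le_card 0 β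
  have hβ' := p.pos_le_card 0 β'
  rcases h with h | ⟨h1, δ, h2, h3⟩ <;> rcases h' with h' | ⟨h1', δ', h2', h3'⟩
  · omega
  · omega
  · omega
  · have : δ = δ' := p.pos_injective 1 (by omega)
    subst this
    omega

theorem SGraph.unique {p : RauzyPair A} {α β β' : A} (h : p.SGraph α β) (h' : p.SGraph α β') : β = β' := by
  rcases h with ⟨h1, h2⟩ | ⟨γ, h1, h2⟩ <;> rcases h' with ⟨h1', h2'⟩ | ⟨γ', h1', h2'⟩
  · exact p.pos_injective 0 (by omega)
  · have := p.one_le_pos 1 γ'; omega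
  · have := p.one_le_pos 1 γ; omega
  · obtain rfl : γ = γ' := p.pos_injective 1 (by omega)
    exact h2.unique h2'

section

variable [Nonempty A] (p : RauzyPair A)

theorem pos_eq_iff (ε : Fin 2) {k : ℕ} (h1 : 1 ≤ k) (hk : k ≤ Fintype.card A) (b : A) :
    p.pos ε b = k ↔ b = p.letter ε k := by
  rw [← p.pos_letter ε k h1 hk, (p.pos_injective ε).eq_iff, p.pos_letter ε k h1 hk]

theorem sGraph_S (α : A) : p.SGraph α (p.S α) := by
  have hn : 1 ≤ Fintype.card A := Fintype.card_pos
  have hα := p.one_le_pos 1 α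
  have hα' := p.pos_le_card 1 α
  unfold S
  split_ifs with h1 h2
  · exact .inl ⟨h1, p.pos_letter 0 1 le_rfl hn⟩
  · have hz := p.pos_letter 0 _ hn le_rfl
    have hw := p.pos_letter 1 _ hn le_rfl
    refine .inr ⟨_, h2, .inr ⟨hz, _, hw, p.pos_letter 0 _ (by omega) ?_⟩⟩
    have := p.pos_le_card 0 (p.letter 1 (Fintype.card A))
    -- If the rows ended with the same letter, `α` would stand at position `n + 1` of the second
    -- row; hence the default value of `letter` does not occur.
    by_contra hlt
    have e : p.letter 1 (Fintype.card A) = p.letter 0 (Fintype.card A) :=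
      (p.pos_eq_iff 0 hn le_rfl _).1 (by omega)
    rw [e] at hw
    omega
  · have hg := p.pos_letter 1 (p.pos 1 α - 1) (by omega) (by omega)
    refine .inr ⟨_, ?_, .inl (p.pos_letter 0 _ (by omega) ?_)⟩
    · omega
    · have := p.pos_le_card 0 (p.letter 1 (p.pos 1 α - 1))
      by_contra hlt
      have e : p.letter 1 (p.pos 1 α - 1) = p.letter 0 (Fintype.card A) :=
        (p.pos_eq_iff 0 hn le_rfl _).1 (by omega)
      rw [e] at hg
      omega

variable {p}

theorem YGraph.Y_eq {α β : A} (h : p.YGraph α β) : p.Y α = β := by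
  unfold YGraph at h
  unfold Y
  split_ifs at h ⊢ with h1
  · obtain ⟨γ, h2, h3⟩ := h
    obtain rfl := h2.unique (p.sGraph_S α)
    exact (p.sGraph_S _).unique h3
  · exact (p.sGraph_S _).unique h

variable (p)

theorem yGraph_Y (α : A) : p.YGraph α (p.Y α) := by
  unfold YGraph Y
  split_ifs with h1
  · exact ⟨_, p.sGraph_S α, p.sGraph_S _⟩
  · exact p.sGraph_S α

end

/-- The first letter of the second row is not the first letter of the first row. -/
theorem IsIrreducible.pos_one_ne {p : RauzyPair A} (hp : p.IsIrreducible)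
    (hn : 2 ≤ Fintype.card A) {a : A} (h0 : p.pos 0 a = 1) (h1 : p.pos 1 a = 1) : False := by
  have := (hp 1 le_rfl (by omega)).1 (by
    ext b
    simp only [Set.mem_ofPred_eq]
    have e : ∀ ε, p.pos ε a = 1 → (p.pos ε b ≤ 1 ↔ b = a) := fun ε h => by
      have := p.one_le_pos ε b
      constructor
      · intro hb; exact p.pos_injective ε (by omega)
      · rintro rfl; omega
    rw [e 0 h0, e 1 h1])
  omega

section Moves

variable {p p' : RauzyPair A}

/-- `S` steps back in the second row and then forward in the first, where the last letter `z` is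
continued by the successor of the last letter of the second row. The move puts the last letter of
the second row behind `z`, and that rule for `z` compensates exactly for the changed neighbours. -/
theorem SGraph.rightZero (hm : IsRauzyMove 0 p p') {α β : A} (h : p.SGraph α β) :
    p'.SGraph α β := by
  have hα := p.one_le_pos 1 α
  have hn : 1 ≤ Fintype.card A := hα.trans (p.pos_le_card 1 α)
  obtain ⟨z, hz⟩ := p.exists_pos_eq 0 hn le_rfl
  have e0 : ∀ b, p'.pos 0 b = p.pos 0 b := fun b => by simp [pos, hm.1]
  have e1 := hm.2 z hz
  have hk := p.one_le_pos 1 z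
  have hkn := p.pos_le_card 1 z
  have hle := p.pos_le_card 1
  have inj := p.pos_injective 1
  simp only [sub_zero] at e1
  rcases h with ⟨h1, h2⟩ | ⟨γ, h1, h2⟩
  · left
    rw [e1, e0, if_pos (by omega)]
    exact ⟨h1, h2⟩
  · right
    have hγα := hle α
    rcases h2 with h2 | ⟨h2, δ, h3, h4⟩
    · have hγz : γ ≠ z := by
        rintro rfl
        have := p.pos_le_card 0 β
        omega
      have hγz' : p.pos 1 γ ≠ p.pos 1 z := fun e => hγz (inj e)
      by_cases hα1 : p.pos 1 z < p.pos 1 α ∧ p.pos 1 α = Fintype.card A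
      -- `α` is the letter that moves: its new predecessor is `z`, and its old predecessor `γ`
      -- becomes the last letter of the second row.
      · refine ⟨z, ?_, .inr ⟨by rw [e0, hz], γ, ?_, ?_⟩⟩
        · rw [e1, e1, if_neg (by omega), if_neg (by omega), if_pos le_rfl]
        · rw [e1, if_neg (by omega), if_pos (by omega)]
          omega
        · rw [e0, e0, h2]
      · refine ⟨γ, ?_, .inl (by rw [e0, e0, h2])⟩
        rw [e1, e1]
        split_ifs <;> omega
    · obtain rfl : γ = z := p.pos_injective 0 (by omega)
      by_cases hδ : p.pos 1 γ + 1 = Fintype.card A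
      · refine ⟨γ, ?_, .inr ⟨by rw [e0, hz], δ, ?_, by rw [e0, e0, h4]⟩⟩ <;>
          simp only [e1] <;> split_ifs <;> omega
      · refine ⟨δ, ?_, .inl (by rw [e0, e0, h4])⟩
        simp only [e1]
        split_ifs <;> omega

theorem SGraph.rightOne (hm : IsRauzyMove 1 p p') {α β : A} (h : p.SGraph α β) :
    p'.SGraph α β := by
  have hα := p.one_le_pos 1 α
  have hn : 1 ≤ Fintype.card A := hα.trans (p.pos_le_card 1 α)
  obtain ⟨z, hz⟩ := p.exists_pos_eq 1 hn le_rfl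
  have e0 : ∀ b, p'.pos 1 b = p.pos 1 b := fun b => by simp [pos, hm.1]
  have e1 := hm.2 z hz
  have hk := p.one_le_pos 0 z
  have hkn := p.pos_le_card 0 z
  have hle := p.pos_le_card 0
  have inj := p.pos_injective 0
  simp only [sub_self] at e1
  rcases h with ⟨h1, h2⟩ | ⟨γ, h1, h2⟩
  · left
    rw [e1, e0, if_pos (by omega)]
    exact ⟨h1, h2⟩
  · right
    refine ⟨γ, by rw [e0, e0, h1], ?_⟩
    have hγα := p.pos_le_card 1 α
    have hβ := hle β
    have hγz : γ ≠ z := by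
      rintro rfl
      omega
    have hγz' : p.pos 0 γ ≠ p.pos 0 z := fun e => hγz (inj e)
    rcases h2 with h2 | ⟨h2, δ, h3, h4⟩
    · by_cases hβ1 : p.pos 0 z < p.pos 0 β ∧ p.pos 0 β = Fintype.card A
      · refine .inr ⟨?_, z, by rw [e0, hz], ?_⟩
        · rw [e1]; split_ifs <;> omega
        · rw [e1, e1]; split_ifs <;> omega
      · left
        rw [e1, e1]
        split_ifs <;> omega
    · obtain rfl : δ = z := p.pos_injective 1 (by omega)
      by_cases hδ : p.pos 0 δ + 1 = Fintype.card A
      · refine .inr ⟨?_, δ, by rw [e0, hz], ?_⟩ <;>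
          simp only [e1] <;> split_ifs <;> omega
      · left
        simp only [e1]
        split_ifs <;> omega

theorem YGraph.rightZero (hm : IsRauzyMove 0 p p') {α β : A} (h : p.YGraph α β) :
    p'.YGraph α β := by
  have hα := p.one_le_pos 1 α
  have hn : 1 ≤ Fintype.card A := hα.trans (p.pos_le_card 1 α)
  obtain ⟨z, hz⟩ := p.exists_pos_eq 0 hn le_rfl
  have e1 := hm.2 z hz α
  have hk := p.one_le_pos 1 z
  simp only [sub_zero] at e1
  unfold YGraph at h ⊢
  split_ifs at h with h1
  · obtain ⟨γ, h2, h3⟩ := h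
    rw [if_pos (by rw [e1]; split_ifs <;> omega)]
    exact ⟨γ, h2.rightZero hm, h3.rightZero hm⟩
  · rw [if_neg (by rw [e1]; split_ifs <;> omega)]
    exact h.rightZero hm

theorem YGraph.rightOne (hm : IsRauzyMove 1 p p') {α β : A} (h : p.YGraph α β) :
    p'.YGraph α β := by
  have e0 : p'.pos 1 α = p.pos 1 α := by simp [pos, hm.1]
  unfold YGraph at h ⊢
  rw [e0]
  split_ifs at h ⊢ with h1
  · obtain ⟨γ, h2, h3⟩ := h
    exact ⟨γ, h2.rightOne hm, h3.rightOne hm⟩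
  · exact h.rightOne hm

theorem Follows.pos_ne_one {γ β : A} (h : p.Follows γ β) : p.pos 0 β ≠ 1 := by
  have := p.one_le_pos 0 γ
  rcases h with h | ⟨-, δ, -, h⟩
  · omega
  · have := p.one_le_pos 0 δ
    omega

theorem SGraph.exists_follows {α β : A} (h : p.SGraph α β) (hα : p.pos 1 α ≠ 1) :
    ∃ γ, p.pos 1 α = p.pos 1 γ + 1 ∧ p.Follows γ β :=
  h.resolve_left fun h => hα h.1

theorem SGraph.pos_eq_one {α β : A} (h : p.SGraph α β) (hα : p.pos 1 α = 1) :
    p.pos 0 β = 1 := by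
  rcases h with ⟨-, h⟩ | ⟨γ, h, -⟩
  · exact h
  · have := p.one_le_pos 1 γ
    omega

/-- Either `α` is not the first letter of the second row and has a predecessor there, or it is
replaced by the first letter of the first row. -/
theorem YGraph.cases {a α β : A} (ha : p.pos 0 a = 1) (hα : α ≠ a)
    (h : p.YGraph α β) :
    (p.pos 1 α = 1 ∧ ∃ γ, p.pos 1 a = p.pos 1 γ + 1 ∧ p.Follows γ β) ∨
      (p.pos 1 α ≠ 1 ∧ ∃ γ, p.pos 1 α = p.pos 1 γ + 1 ∧ p.Follows γ β) := by
  unfold YGraph at h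
  split_ifs at h with h1
  · obtain ⟨γ, h2, h3⟩ := h
    obtain rfl : γ = a := p.pos_injective 0 (by rw [h2.pos_eq_one h1, ha])
    refine .inl ⟨h1, h3.exists_follows fun h4 => hα ?_⟩
    exact p.pos_injective 1 (by omega)
  · exact .inr ⟨h1, h.exists_follows h1⟩

theorem YGraph.of_pred {α β γ : A} (h : p.pos 1 α = p.pos 1 γ + 1) (hf : p.Follows γ β) :
    p.YGraph α β := by
  have := p.one_le_pos 1 γ
  unfold YGraph
  rw [if_neg (by omega)]
  exact .inr ⟨γ, h, hf⟩

theorem YGraph.of_first {a α β γ : A} (ha : p.pos 0 a = 1) (hα : p.pos 1 α = 1)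
    (h : p.pos 1 a = p.pos 1 γ + 1) (hf : p.Follows γ β) : p.YGraph α β := by
  unfold YGraph
  rw [if_pos hα]
  exact ⟨a, .inl ⟨hα, ha⟩, .inr ⟨γ, h, hf⟩⟩

/-- The first letter of the second row reaches its image through `a`, that is, through the
predecessor of `a`. After the move it stands right before `a` and has this predecessor itself, while
the new first letter passes through `a` back to it. -/
theorem YGraph.leftZero (hp : p.IsIrreducible) (hm : IsLeftRauzyMove 0 p p') {a α β : A}
    (ha : p.pos 0 a = 1) (hα : α ≠ a) (h : p.YGraph α β) : p'.YGraph α β := by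
  have hα1 := p.one_le_pos 0 α
  have hαa : p.pos 0 α ≠ p.pos 0 a := fun e => hα (p.pos_injective 0 e)
  have hn : 2 ≤ Fintype.card A := by
    have := p.pos_le_card 0 α
    omega
  have hk : p.pos 1 a ≠ 1 := fun h => hp.pos_one_ne hn ha h
  have hk1 := p.one_le_pos 1 a
  have hkn := p.pos_le_card 1 a
  have e0 : ∀ b, p'.pos 0 b = p.pos 0 b := fun b => by simp [pos, hm.1]
  have e1 := hm.2 a ha
  simp only [sub_zero] at e1
  have hF : ∀ γ, p.Follows γ β → p'.Follows γ β := fun γ h => by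
    rcases h with h | ⟨h, δ, h1, h2⟩
    · exact .inl (by rw [e0, e0, h])
    · refine .inr ⟨by rw [e0, h], δ, ?_, by rw [e0, e0, h2]⟩
      rw [e1]
      split_ifs <;> omega
  have ha' : p'.pos 1 a = p.pos 1 a := by rw [e1, if_neg hk, if_neg (by omega)]
  have ha0 : p'.pos 0 a = 1 := by rw [e0, ha]
  rcases h.cases ha hα with ⟨h1, γ, h2, h3⟩ | ⟨h1, γ, h2, h3⟩
  · by_cases h4 : p.pos 1 a = 2
    · obtain rfl : γ = α := p.pos_injective 1 (by omega)
      refine .of_first ha0 ?_ ?_ (hF _ h3)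
      · rw [e1, if_pos h1]; omega
      · rw [ha', e1, if_pos h1]; omega
    · refine .of_pred (γ := γ) ?_ (hF _ h3)
      rw [e1, e1, if_pos h1, if_neg (by omega), if_pos (by omega)]
      omega
  · have hαa' : p.pos 1 α ≠ p.pos 1 a := fun e => hα (p.pos_injective 1 e)
    have h1γ := p.one_le_pos 1 γ
    by_cases h4 : p.pos 1 γ = 1
    · refine .of_first ha0 ?_ (γ := γ) ?_ (hF _ h3)
      · rw [e1, if_neg h1, if_pos (by omega)]; omega
      · rw [ha', e1, if_pos h4]; omega
    · refine .of_pred (γ := γ) ?_ (hF _ h3)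
      rw [e1, e1]
      split_ifs <;> omega

/-- A left move of type one conjugates `Y`: the first letter `a` of the second row takes the place
of the second letter `s` of the first row, and the first letter `w` of the first row the place of
`a`. -/
theorem YGraph.leftOne [DecidableEq A] (hp : p.IsIrreducible) (hm : IsLeftRauzyMove 1 p p')
    {a s w α β : A} (ha : p.pos 1 a = 1) (hw : p.pos 0 w = 1) (hs : p.pos 0 s = 2)
    (hsa : s ≠ a) (hα : α ≠ w) (h : p.YGraph α β) :
    p'.YGraph ((Equiv.swap a s * Equiv.swap a w) α) ((Equiv.swap a s * Equiv.swap a w) β) := by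
  have hn : 2 ≤ Fintype.card A := by
    have := p.pos_le_card 0 s
    omega
  have hk : p.pos 0 a ≠ 1 := fun h => hp.pos_one_ne hn h ha
  have hk1 := p.one_le_pos 0 a
  have hkn := p.pos_le_card 0 a
  have hsa' : p.pos 0 s ≠ p.pos 0 a := fun e => hsa (p.pos_injective 0 e)
  have hwa : w ≠ a := by rintro rfl; exact hk hw
  have hws : w ≠ s := by rintro rfl; omega
  have e0 : ∀ b, p'.pos 1 b = p.pos 1 b := fun b => by simp [pos, hm.1]
  have e1 := hm.2 a ha
  simp only [sub_self] at e1
  -- `φ` is the cycle `a ↦ w ↦ s ↦ a`. The first row changes from `w s … a …` to `s … w a …`, so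
  -- whenever `β` used to follow `γ`, now `φ β` follows `γ`.
  set φ := Equiv.swap a s * Equiv.swap a w with hφ
  have φa : φ a = w := by
    rw [hφ, Equiv.Perm.mul_apply, Equiv.swap_apply_left, Equiv.swap_apply_of_ne_of_ne hwa hws]
  have φs : φ s = a := by
    rw [hφ, Equiv.Perm.mul_apply, Equiv.swap_apply_of_ne_of_ne hsa hws.symm,
      Equiv.swap_apply_right]
  have φo : ∀ b, b ≠ a → b ≠ s → b ≠ w → φ b = b := fun b h1 h2 h3 => by
    rw [hφ, Equiv.Perm.mul_apply, Equiv.swap_apply_of_ne_of_ne h1 h3,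
      Equiv.swap_apply_of_ne_of_ne h1 h2]
  have hpos : ∀ γ β : A, p.pos 0 β = p.pos 0 γ + 1 → p'.pos 0 (φ β) = p'.pos 0 γ + 1 := by
    intro γ β h
    have := p.one_le_pos 0 γ
    by_cases hβa : β = a
    · subst hβa
      rw [φa, e1, e1, if_pos hw, if_neg (by omega), if_pos (by omega)]
      omega
    by_cases hβs : β = s
    · subst hβs
      rw [φs, e1, e1, if_neg (by omega), if_neg (by omega), if_pos (by omega)]
      omega
    have hβa' : p.pos 0 β ≠ p.pos 0 a := fun e => hβa (p.pos_injective 0 e)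
    have hβs' : p.pos 0 β ≠ p.pos 0 s := fun e => hβs (p.pos_injective 0 e)
    rw [φo β hβa hβs (by rintro rfl; omega), e1, e1]
    split_ifs <;> omega
  have hF : ∀ γ, p.Follows γ β → p'.Follows γ (φ β) := fun γ h => by
    rcases h with h | ⟨h, δ, h1, h2⟩
    · exact .inl (hpos _ _ h)
    · refine .inr ⟨?_, δ, by rw [e0, h1], hpos _ _ h2⟩
      rw [e1]
      split_ifs <;> omega
  have hs0 : p'.pos 0 s = 1 := by rw [e1, if_neg (by omega), if_pos (by omega)]; omega
  rcases h.cases hw hα with ⟨h1, γ, h2, h3⟩ | ⟨h1, γ, h2, h3⟩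
  · obtain rfl : α = a := p.pos_injective 1 (by omega)
    rw [φa]
    exact .of_pred (by rw [e0, e0, h2]) (hF _ h3)
  · by_cases hαs : α = s
    · subst hαs
      rw [φs]
      exact .of_first hs0 (by rw [e0, ha]) (by rw [e0, e0, h2]) (hF _ h3)
    · rw [φo α (by rintro rfl; exact h1 ha) hαs hα]
      exact .of_pred (by rw [e0, e0, h2]) (hF _ h3)

end Moves

section List

theorem Y_ne [Nonempty A] {p : RauzyPair A} {α : A} (hα : α ≠ p.letter 0 1) :
    p.Y α ≠ p.letter 0 1 := by
  have h1 := p.pos_letter 0 1 le_rfl Fintype.card_pos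
  intro h
  rcases (p.yGraph_Y α).cases h1 hα with ⟨-, γ, -, hf⟩ | ⟨-, γ, -, hf⟩ <;>
  exact hf.pos_ne_one (by rw [h, h1])

variable [Nonempty A] [DecidableEq A] {p p' : RauzyPair A}

/-- Orbits are carried to orbits by `Cycle.map φ`, which is injective and preserves lengths, so no
two cycles merge in the image. -/
theorem P_eq_of_conj (φ : Equiv.Perm A)
    (h0 : φ (p.letter 0 1) = p'.letter 0 1)
    (h : ∀ α, α ≠ p.letter 0 1 → p'.Y (φ α) = φ (p.Y α)) : p.P = p'.P := by
  have hit : ∀ (n : ℕ) (α : A), α ≠ p.letter 0 1 →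
      p'.Y^[n] (φ α) = φ (p.Y^[n] α) ∧ p.Y^[n] α ≠ p.letter 0 1 := by
    intro n
    induction n with
    | zero => exact fun α hα => ⟨rfl, hα⟩
    | succ n ih =>
      intro α hα
      obtain ⟨h1, h2⟩ := ih α hα
      rw [Function.iterate_succ_apply', Function.iterate_succ_apply', h1, h _ h2]
      exact ⟨rfl, Y_ne h2⟩
  have hmin : ∀ α, α ≠ p.letter 0 1 →
      Function.minimalPeriod p'.Y (φ α) = Function.minimalPeriod p.Y α := fun α hα => by
    rw [Function.minimalPeriod_eq_minimalPeriod_iff]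
    intro n
    simp only [Function.IsPeriodicPt, Function.IsFixedPt, (hit n α hα).1, φ.injective.eq_iff]
  have horb : ∀ α, α ≠ p.letter 0 1 →
      Function.periodicOrbit p'.Y (φ α) = (Function.periodicOrbit p.Y α).map φ := fun α hα => by
    rw [Function.periodicOrbit, Function.periodicOrbit, hmin α hα, Cycle.map_coe, List.map_map]
    congr 1
    exact List.map_congr_left fun n _ => (hit n α hα).1
  have himg : (Finset.univ.erase (p'.letter 0 1)).image (Function.periodicOrbit p'.Y) =
      ((Finset.univ.erase (p.letter 0 1)).image (Function.periodicOrbit p.Y)).image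
        (Cycle.map φ) := by
    have : Finset.univ.erase (p'.letter 0 1) = (Finset.univ.erase (p.letter 0 1)).image φ := by
      rw [← h0]
      ext b
      simp only [Finset.mem_erase, Finset.mem_univ, and_true, Finset.mem_image]
      exact ⟨fun hb => ⟨φ.symm b, fun e => hb (by rw [← e]; simp), by simp⟩,
        fun ⟨c, hc, e⟩ => e ▸ φ.injective.ne hc⟩
    rw [this, Finset.image_image, Finset.image_image]
    refine Finset.image_congr fun α hα => horb α ?_
    simpa using hα
  have hinj : Function.Injective (Cycle.map φ) := by
    intro c d hcd
    have hφ : ∀ c : Cycle A, (c.map φ).map φ.symm = c := fun c =>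
      Quotient.inductionOn' c fun l => by simp [Cycle.mk''_eq_coe]
    rw [← hφ c, hcd, hφ]
  unfold P
  rw [himg, Finset.image_val_of_injOn hinj.injOn, Multiset.map_map]
  congr 1
  funext c
  exact Quotient.inductionOn' c fun l => by simp [Cycle.mk''_eq_coe]

theorem P_eq_of_extStep (h : ExtStep p p') : p.P = p'.P := by
  obtain ⟨hp, hp', ε, hm⟩ := h
  have hn : 1 ≤ Fintype.card A := Fintype.card_pos
  have l0 := p.pos_letter 0 1 le_rfl hn
  have key : (∀ b, p.pos 0 b = 1 → p'.pos 0 b = 1) →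
      (∀ α β, α ≠ p.letter 0 1 → p.YGraph α β → p'.YGraph α β) → p.P = p'.P := fun h1 h2 =>
    P_eq_of_conj (Equiv.refl A) ((p'.pos_eq_iff 0 le_rfl hn _).1 (h1 _ l0))
      fun α hα => (h2 α _ hα (p.yGraph_Y α)).Y_eq
  obtain rfl | rfl : ε = 0 ∨ ε = 1 := by fin_cases ε <;> simp
  · rcases hm with hm | hm
    · exact key (fun b hb => by simpa [pos, hm.1] using hb) fun α β _ h => h.rightZero hm
    · exact key (fun b hb => by simpa [pos, hm.1] using hb)
        fun α β hα h => h.leftZero hp hm l0 hα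
  · rcases hm with hm | hm
    · refine key (fun b hb => ?_) fun α β _ h => h.rightOne hm
      obtain ⟨z, hz⟩ := p.exists_pos_eq 1 hn le_rfl
      have e := hm.2 z hz b
      simp only [sub_self] at e
      rw [e, if_pos (by rw [hb]; exact p.one_le_pos 0 z), hb]
    · by_cases hn2 : Fintype.card A = 1
      · have : Subsingleton A := Fintype.card_le_one_iff_subsingleton.1 hn2.le
        have : p = p' := words_injective (Prod.ext
          (List.ext_getElem (by simp [words]) fun _ _ _ => Subsingleton.elim _ _)
          (List.ext_getElem (by simp [words]) fun _ _ _ => Subsingleton.elim _ _))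
        rw [this]
      have ha := p.pos_letter 1 1 le_rfl hn
      have hs := p.pos_letter 0 2 (by omega) (by omega)
      -- If `a` is already second in the first row, the move changes nothing.
      by_cases hsa : p.letter 0 2 = p.letter 1 1
      · have e0 : ∀ b, p'.pos 1 b = p.pos 1 b := fun b => by simp [pos, hm.1]
        have e1 := hm.2 _ ha
        simp only [sub_self, ← hsa, hs] at e1
        have e2 : ∀ b, p'.pos 0 b = p.pos 0 b := fun b => by
          rw [e1]
          have := p.one_le_pos 0 b
          split_ifs <;> omega
        have : p = p' := by
          obtain ⟨r⟩ := p
          obtain ⟨r'⟩ := p'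
          congr 1
          funext ε
          ext b
          obtain rfl | rfl : ε = 0 ∨ ε = 1 := by fin_cases ε <;> simp
          · simpa [pos] using (e2 b).symm
          · simpa [pos] using (e0 b).symm
        rw [this]
      · refine P_eq_of_conj (Equiv.swap (p.letter 1 1) (p.letter 0 2) *
          Equiv.swap (p.letter 1 1) (p.letter 0 1)) ?_ fun α hα =>
          ((p.yGraph_Y α).leftOne hp hm ha l0 hs hsa hα).Y_eq
        rw [Equiv.Perm.mul_apply, Equiv.swap_apply_right, Equiv.swap_apply_left]
        refine (p'.pos_eq_iff 0 le_rfl hn _).1 ?_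
        have e1 := hm.2 _ ha
        simp only [sub_self] at e1
        have hne : p.pos 0 (p.letter 0 2) ≠ p.pos 0 (p.letter 1 1) :=
          fun e => hsa (p.pos_injective 0 e)
        have hne1 : p.pos 0 (p.letter 1 1) ≠ 1 := fun e => hp.pos_one_ne (by omega) e ha
        have := p.one_le_pos 0 (p.letter 1 1)
        rw [e1, if_neg (by omega), if_pos (by omega)]
        omega

theorem P_eq_of_eqvGen (h : Relation.EqvGen ExtStep p p') : p.P = p'.P := by
  induction h with
  | rel p q h => exact P_eq_of_extStep h
  | refl p => rfl
  | symm p q _ ih => exact ih.symm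
  | trans p q r _ _ ih ih' => exact ih.trans ih'

end List

end RauzyPair

/-! ### Cycles of a map read from two words -/

namespace RauzyPair

section Cycles

variable {A : Type*} {f : A → A}

/-- The nonempty list `w` is run through by `f`, which maps its last entry to its first one. -/
def IsCycleList (f : A → A) (w : List A) : Prop :=
  ∃ x l, w = x :: l ∧ List.IsChain (fun u v => f u = v) (x :: l ++ [x])

theorem IsCycleList.apply_getElem {w : List A} (h : IsCycleList f w) (i : ℕ)
    (hi : i < w.length) : f w[i] = w[(i + 1) % w.length]'(Nat.mod_lt _ (by omega)) := by
  obtain ⟨x, l, rfl, h⟩ := h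
  rw [List.isChain_iff_getElem] at h
  have := h i (by simpa using hi)
  rw [List.getElem_append_left hi] at this
  rw [this]
  by_cases hl : i + 1 = (x :: l).length
  · simp only [hl, Nat.mod_self]
    simp
  · have hlt : i + 1 < (x :: l).length := by omega
    rw [List.getElem_append_left hlt]
    simp only [Nat.mod_eq_of_lt hlt]

theorem IsCycleList.iterate {w : List A} (h : IsCycleList f w) (n j : ℕ) (hj : j < w.length) :
    f^[n] w[j] = w[(j + n) % w.length]'(Nat.mod_lt _ (by omega)) := by
  induction n with
  | zero => simp [Nat.mod_eq_of_lt hj]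
  | succ n ih =>
    rw [Function.iterate_succ_apply', ih, h.apply_getElem]
    congr 1
    rw [Nat.mod_add_mod, add_assoc]

theorem IsCycleList.periodicOrbit_eq {w : List A} (h : IsCycleList f w) (hn : w.Nodup) {x : A}
    (hx : x ∈ w) : Function.periodicOrbit f x = w := by
  obtain ⟨j, hj, rfl⟩ := List.getElem_of_mem hx
  have hper : ∀ n, Function.IsPeriodicPt f n w[j] ↔ w.length ∣ n := fun n => by
    rw [Function.IsPeriodicPt, Function.IsFixedPt, h.iterate, hn.getElem_inj_iff]
    constructor
    · intro e
      have h1 : (j + n) % w.length = (j + 0) % w.length := by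
        rw [e, add_zero, Nat.mod_eq_of_lt hj]
      exact (Nat.modEq_zero_iff_dvd).1 (Nat.ModEq.add_left_cancel' j h1)
    · rintro ⟨k, rfl⟩
      rw [Nat.add_mul_mod_self_left, Nat.mod_eq_of_lt hj]
  have hmin : Function.minimalPeriod f w[j] = w.length :=
    Nat.dvd_antisymm (((hper _).2 dvd_rfl).minimalPeriod_dvd)
      ((hper _).1 (Function.isPeriodicPt_minimalPeriod _ _))
  rw [Function.periodicOrbit, hmin, Cycle.coe_eq_coe]
  refine List.IsRotated.symm ⟨j, List.ext_getElem (by simp) fun i h1 h2 => ?_⟩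
  rw [List.getElem_rotate, List.getElem_map, List.getElem_range, h.iterate]
  simp only [add_comm]

theorem P_eq_of_cycles [Fintype A] [Nonempty A] [DecidableEq A] {p : RauzyPair A}
    {cs : List (List A)} (hc : ∀ c ∈ cs, IsCycleList p.Y c) (hn : cs.flatten.Nodup)
    (hm : ∀ b, b ∈ cs.flatten ↔ b ≠ p.letter 0 1) : p.P = (cs.map List.length : Multiset ℕ) := by
  have horb : ∀ c ∈ cs, ∀ x ∈ c, Function.periodicOrbit p.Y x = c := fun c h x hx =>
    (hc c h).periodicOrbit_eq ((List.nodup_flatten.1 hn).1 c h) hx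
  have key : ((Finset.univ.erase (p.letter 0 1)).image (Function.periodicOrbit p.Y)).val =
      ((cs.map (fun c : List A => (c : Cycle A)) : List (Cycle A)) : Multiset (Cycle A)) := by
    refine (Multiset.Nodup.ext (Finset.nodup _) ?_).2 fun C => ?_
    · rw [Multiset.coe_nodup, List.Nodup, List.pairwise_map]
      refine (List.nodup_flatten.1 hn).2.imp_of_mem fun {c d} h1 h2 hd e => ?_
      obtain ⟨x, l, rfl, -⟩ := hc c h1
      have : x ∈ (d : Cycle A) := by rw [← e]; simp
      exact hd List.mem_cons_self (by simpa using this)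
    · simp only [Finset.mem_val, Finset.mem_image, Finset.mem_erase, Finset.mem_univ, and_true,
        Multiset.mem_coe, List.mem_map]
      constructor
      · rintro ⟨x, hx, rfl⟩
        obtain ⟨c, h1, h2⟩ := List.mem_flatten.1 ((hm x).2 hx)
        exact ⟨c, h1, (horb c h1 x h2).symm⟩
      · rintro ⟨c, h1, rfl⟩
        obtain ⟨x, l, rfl, -⟩ := hc c h1
        exact ⟨x, (hm x).1 (List.mem_flatten.2 ⟨_, h1, List.mem_cons_self⟩),
          horb _ h1 x List.mem_cons_self⟩
  rw [P, key, Multiset.map_coe, List.map_map]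
  rfl

/-- The entries in even position and the entries in odd position, counted from zero. -/
def alternate : List A → List A × List A
  | [] => ([], [])
  | x :: l => (x :: (alternate l).2, (alternate l).1)

theorem alternate_append_of_even {l : List A} (h : Even l.length) (y : A) :
    alternate (l ++ [y]) = ((alternate l).1 ++ [y], (alternate l).2) := by
  induction l using List.twoStepInduction with
  | nil => rfl
  | singleton x => simp at h
  | cons_cons x y l ih _ =>
    have h' : Even l.length := by simp only [List.length_cons] at h; grind
    simp [alternate, ih h']

theorem alternate_append_of_odd {l : List A} (h : ¬ Even l.length) (y : A) :
    alternate (l ++ [y]) = ((alternate l).1, (alternate l).2 ++ [y]) := by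
  cases l with
  | nil => simp at h
  | cons x l =>
    have h' : Even l.length := by simp only [List.length_cons] at h; grind
    simp [alternate, alternate_append_of_even h']

theorem length_alternate : ∀ l : List A,
    (alternate l).1.length = (l.length + 1) / 2 ∧ (alternate l).2.length = l.length / 2
  | [] => by simp [alternate]
  | x :: l => by
    have := length_alternate l
    simp only [alternate, List.length_cons]
    omega

theorem alternate_perm : ∀ l : List A, ((alternate l).1 ++ (alternate l).2).Perm l
  | [] => .refl _
  | x :: l => by
    simp only [alternate, List.cons_append]
    exact (List.perm_append_comm.trans (alternate_perm l)).cons x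

/-- `f` maps each entry to the one two places later. -/
def Skips (f : A → A) : List A → Prop
  | p :: q :: r :: l => f p = r ∧ Skips f (q :: r :: l)
  | _ => True

theorem Skips.isChain : ∀ {l : List A}, Skips f l →
    List.IsChain (fun u v => f u = v) (alternate l).1 ∧
      List.IsChain (fun u v => f u = v) (alternate l).2
  | [], _ => by simp [alternate]
  | [_], _ => by simp [alternate]
  | [_, _], _ => by simp [alternate]
  | p :: q :: r :: l, h => by
    have := Skips.isChain h.2
    simp only [alternate] at this ⊢
    exact ⟨List.isChain_cons_cons.2 ⟨h.1, this.2⟩, this.1⟩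

/-- `u` and `v` are consecutive in the list `l`. -/
def Consecutive (l : List A) (u v : A) : Prop := ∃ s t, l = s ++ u :: v :: t

theorem isChain_consecutive (l : List A) : List.IsChain (Consecutive l) l := by
  suffices H : ∀ l₂ l₁, l = l₁ ++ l₂ → List.IsChain (Consecutive l) l₂ from H l [] rfl
  intro l₂
  induction l₂ with
  | nil => simp
  | cons x l₂ ih =>
    intro l₁ h
    cases l₂ with
    | nil => simp
    | cons y l₂ => exact List.isChain_cons_cons.2 ⟨⟨l₁, l₂, h⟩, ih (l₁ ++ [x]) (by simp [h])⟩

/-- Stepping back along a reversed block is stepping forward in the unreversed one, so one step back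
in `B` and one forward in `T` add up to two places. -/
theorem skips_of_isChain {R S : A → A → Prop} (hf : ∀ u x y, R u x → S u y → f x = y) :
    ∀ (c : List A) (x y : A), List.IsChain (fun p q => R q p) (x :: c) →
      List.IsChain S (c ++ [y]) → Skips f (x :: (c ++ [y]))
  | [], _, _, _, _ => trivial
  | q :: c, x, y, h, h' => by
    rw [List.isChain_cons_cons] at h
    obtain ⟨r, t, ht⟩ : ∃ r t, c ++ [y] = r :: t := List.exists_cons_of_ne_nil (by simp)
    have ih := skips_of_isChain hf c q y h.2 (by
      rw [List.cons_append] at h'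
      exact h'.tail)
    rw [List.cons_append, ht] at h' ⊢
    rw [ht] at ih
    exact ⟨hf q x r h.1 (List.isChain_cons_cons.1 h').1, ih⟩

/-- The cycles of the map that moves one step back in the word `B` and one step forward in the
word `T`, for words that differ by the reversal of blocks. -/
theorem exists_cycles {T B : List A} {z : A}
    (hf : ∀ u x y, Consecutive B u x → Consecutive T u y → f x = y) {L : List ℕ} {V V' : List A}
    (hV : Blocks L V V') (hL : ∀ s ∈ L, 0 < s) :
    ∀ (τ β D : List A), T = τ ++ (V ++ [z]) → B = β ++ (V' ++ [z]) →
      (∀ x t y t', V' ++ [z] = x :: t → V ++ [z] = y :: t' →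
        List.IsChain (fun u v => f u = v) (x :: (D ++ [y]))) →
      ∃ cs : List (List A), cs.map List.length = blockCycles D.length L ∧
        (∀ c ∈ cs, IsCycleList f c) ∧ cs.flatten.Perm (D ++ (V ++ [z])) := by
  -- `D` holds the pending letters: `f` leads from the first remaining letter of `B` through `D` to
  -- the first remaining letter of `T`.
  induction hV with
  | nil =>
    intro τ β D _ _ hD
    refine ⟨[z :: D], by simp [blockCycles, add_comm], ?_, ?_⟩
    · intro c hc
      rw [List.mem_singleton] at hc
      exact ⟨z, D, hc, hD z [] z [] rfl rfl⟩
    · simpa using (List.perm_append_singleton z D).symm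
  | @cons c L V V' hV ih =>
    intro τ β D hT hB hD
    have hc : 0 < c.length := hL _ List.mem_cons_self
    have ih := ih fun s hs => hL s (List.mem_cons_of_mem _ hs)
    obtain ⟨x', t, hx'⟩ : ∃ r t, V' ++ [z] = r :: t := List.exists_cons_of_ne_nil (by simp)
    obtain ⟨y', t', hy'⟩ : ∃ r t, V ++ [z] = r :: t := List.exists_cons_of_ne_nil (by simp)
    obtain ⟨c0, c'', hc0⟩ : ∃ r t, c = r :: t :=
      List.exists_cons_of_ne_nil (List.ne_nil_of_length_pos hc)
    obtain ⟨k, m, hk⟩ : ∃ k m, c = k ++ [m] :=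
      ⟨_, _, (List.dropLast_append_getLast (List.ne_nil_of_length_pos hc)).symm⟩
    have hDc := hD m (k.reverse ++ (V' ++ [z])) c0 (c'' ++ (V ++ [z])) (by simp [hk])
      (by simp [hc0])
    -- `x'` and `y'` are the letters right behind the block in `B` and in `T`.
    have hskip : Skips f (x' :: (c ++ [y'])) := by
      refine skips_of_isChain hf c x' y' ?_ ?_
      · have h1 : List.IsChain (Consecutive B) (x' :: c).reverse :=
          (isChain_consecutive B).infix ⟨β, t, by rw [hB]; simp [hx']⟩
        rwa [List.isChain_reverse] at h1
      · exact (isChain_consecutive T).infix ⟨τ, t', by rw [hT]; simp [hy']⟩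
    have hch := hskip.isChain
    simp only [alternate] at hch
    have hlen := length_alternate c
    have hperm := alternate_perm c
    have he0 : (alternate c).1 = c0 :: (alternate c'').2 := by rw [hc0, alternate]
    have hT' : T = (τ ++ c) ++ (V ++ [z]) := by simpa using hT
    have hB' : B = (β ++ c.reverse) ++ (V' ++ [z]) := by simpa using hB
    by_cases hs : Even c.length
    · have hko : ¬ Even k.length := by
        rw [hk] at hs
        simp only [List.length_append, List.length_cons, List.length_nil] at hs
        grind
      rw [alternate_append_of_even hs] at hch
      have hek : (alternate c).2 = (alternate k).2 ++ [m] := by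
        rw [hk, alternate_append_of_odd hko]
      obtain ⟨cs, h1, h2, h3⟩ := ih (τ ++ c) (β ++ c.reverse)
        ((alternate c).2 ++ (D ++ (alternate c).1)) hT' hB' (by
          intro x s y s' hx hy
          obtain ⟨rfl, -⟩ : x = x' ∧ s = t := by simpa using hx.symm.trans hx'
          obtain ⟨rfl, -⟩ : y = y' ∧ s' = t' := by simpa using hy.symm.trans hy'
          rw [he0, hek] at hch ⊢
          -- For an even block the path from `x` ends at the last letter `m` of the block, continues
          -- through `D` to the first letter `c0`, and leaves at `y`: one path that has absorbed the
          -- whole block.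
          have g := List.isChain_split (l₁ := x :: (alternate k).2) (c := m)
            (l₂ := D ++ c0 :: ((alternate c'').2 ++ [y])) |>.2 ⟨by simpa using hch.1,
              List.isChain_split (l₁ := m :: D) |>.2 ⟨hDc, hch.2⟩⟩
          convert g using 1
          simp)
      refine ⟨cs, ?_, h2, h3.trans ?_⟩
      · rw [h1, blockCycles, if_pos hs]
        congr 1
        simp only [List.length_append]
        grind
      · classical
        rw [List.perm_iff_count] at hperm ⊢
        intro u
        have := hperm u
        simp only [List.count_append] at this ⊢
        omega
    · have hke : Even k.length := by
        rw [hk] at hs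
        simp only [List.length_append, List.length_cons, List.length_nil] at hs
        grind
      rw [alternate_append_of_odd hs] at hch
      have hek : (alternate c).1 = (alternate k).1 ++ [m] := by
        rw [hk, alternate_append_of_even hke]
      obtain ⟨cs, h1, h2, h3⟩ := ih (τ ++ c) (β ++ c.reverse) (alternate c).2 hT' hB' (by
          intro x s y s' hx hy
          obtain ⟨rfl, -⟩ : x = x' ∧ s = t := by simpa using hx.symm.trans hx'
          obtain ⟨rfl, -⟩ : y = y' ∧ s' = t' := by simpa using hy.symm.trans hy'
          simpa using hch.1)
      -- For an odd block the path from `c0` ends at `m` and is closed by `D` to a cycle; the other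
      -- alternate letters form the new pending path.
      refine ⟨((alternate c).1 ++ D) :: cs, ?_, ?_, ?_⟩
      · rw [List.map_cons, h1, blockCycles, if_neg hs, List.length_append, hlen.1, hlen.2]
        congr 2
        grind
      · intro d hd
        rcases List.mem_cons.1 hd with rfl | hd
        · refine ⟨c0, (alternate c'').2 ++ D, by rw [he0]; rfl, ?_⟩
          have g : List.IsChain (fun u v => f u = v) (c0 :: (alternate c'').2) := by
            have := hch.2
            rwa [he0] at this
          rw [← he0, hek] at g
          have g := List.isChain_split.2 ⟨g, hDc⟩
          convert g using 1
          rw [← List.cons_append, ← he0, hek]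
          simp
        · exact h2 d hd
      · classical
        rw [List.perm_iff_count] at hperm h3 ⊢
        intro u
        have e1 := hperm u
        have e2 := h3 u
        simp only [List.count_append, List.flatten_cons] at e1 e2 ⊢
        omega

end Cycles

end RauzyPair

/-! ### Piece-wise order reversing pairs as words, and their list `P` -/

namespace RauzyPair

section

variable {A : Type*}

theorem Blocks.map {B : Type*} (g : A → B) {L : List ℕ} {W W' : List A} (h : Blocks L W W') :
    Blocks L (W.map g) (W'.map g) := by
  induction h with
  | nil => exact .nil
  | cons c h ih => simpa using Blocks.cons (c.map g) ih

theorem Blocks.unique {L : List ℕ} {W W' W'' : List A} (h : Blocks L W W') (h' : Blocks L W W'') :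
    W' = W'' := by
  induction h generalizing W'' with
  | nil => exact h'.nil_right.2.symm
  | cons c h ih =>
    obtain ⟨d, V, V', hd, hV, rfl, h₁⟩ := h'.exists_of_cons
    obtain ⟨rfl, rfl⟩ := List.append_inj hV hd.symm
    rw [ih h₁]

theorem blocks_of_getElem? {L : List ℕ} {W W' : List A} (hW : W.length = L.sum)
    (hW' : W'.length = L.sum)
    (h : ∀ i < L.length, ∀ j, (L.take i).sum ≤ j → j < (L.take (i + 1)).sum →
      W'[(L.take i).sum + (L.take (i + 1)).sum - 1 - j]? = W[j]?) : Blocks L W W' := by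
  induction L generalizing W W' with
  | nil =>
    obtain rfl := List.length_eq_zero_iff.1 hW
    obtain rfl := List.length_eq_zero_iff.1 hW'
    exact .nil
  | cons s L ih =>
    rw [List.sum_cons] at hW hW'
    have h1 : (W.take s).length = s := by simp [hW]
    have h2 : W'.take s = (W.take s).reverse := by
      refine List.ext_getElem? fun k => ?_
      by_cases hk : k < s
      · have := h 0 (by simp) (s - 1 - k) (by simp) (by simp; omega)
        rw [List.getElem?_reverse (by omega), h1, List.getElem?_take_of_lt hk,
          List.getElem?_take_of_lt (by omega), ← this]
        congr 1
        simp
        omega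
      · rw [List.getElem?_eq_none (by simp; omega), List.getElem?_eq_none (by simp; omega)]
    have h3 : Blocks L (W.drop s) (W'.drop s) := by
      refine ih (by simp [hW]) (by simp [hW']) fun i hi j hj hj' => ?_
      have := h (i + 1) (by simpa using hi) (s + j) (by simpa using hj) (by simpa using hj')
      rw [List.getElem?_drop, List.getElem?_drop, ← this]
      congr 1
      simp only [List.take_succ_cons, List.sum_cons]
      omega
    have := Blocks.cons (W.take s) h3
    rwa [h1, ← h2, List.take_append_drop, List.take_append_drop] at this

theorem exists_eq_cons_append {l : List A} {m : ℕ} {a z : A} (hl : l.length = m + 2)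
    (ha : l[0]? = some a) (hz : l[m + 1]? = some z) : ∃ W, W.length = m ∧ l = a :: (W ++ [z]) := by
  obtain ⟨b, t, rfl⟩ : ∃ b t, l = b :: t :=
    List.exists_cons_of_ne_nil (List.ne_nil_of_length_pos (by omega))
  obtain ⟨W, y, rfl⟩ : ∃ W y, t = W ++ [y] :=
    ⟨_, _, (List.dropLast_append_getLast (List.ne_nil_of_length_pos (by simp at hl; omega))).symm⟩
  have hm : W.length = m := by simpa using hl
  subst hm
  simp only [List.getElem?_cons_zero, Option.some.injEq, List.getElem?_cons_succ,
    List.getElem?_concat_length] at ha hz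
  exact ⟨W, rfl, by rw [ha, hz]⟩

/-- The two rows of a standard pair, order reversing in blocks with the sizes in `L`. -/
def BlockWords (L : List ℕ) (u : List A × List A) : Prop :=
  ∃ a z W W', u = (a :: (W ++ [z]), z :: (W' ++ [a])) ∧ Blocks L W W'

/-- The first row of a standard pair has `z` at its end, `BlockForm` has it right behind `a`; a
rotation of the first cyclic word passes between the two. -/
theorem BlockConn.exists_wordConn {L L' : List ℕ} (h : BlockConn A L L') {u : List A × List A}
    (hu : BlockWords L u) : ∃ v, BlockWords L' v ∧ WordConn u v := by
  obtain ⟨a, z, W, W', rfl, hW⟩ := hu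
  obtain ⟨T, B, ⟨y, V, V', hV, rfl, rfl⟩, hc⟩ := h a (z :: W) (z :: W') ⟨z, W, W', hW, rfl, rfl⟩
  refine ⟨_, ⟨a, y, V, V', rfl, hV⟩, ?_⟩
  have h1 := CycConn.rotate (a := a) W [z] [] (z :: W')
  have h2 := CycConn.rotate (a := a) [y] V (y :: V') []
  simp only [List.nil_append, List.append_nil, List.cons_append] at h1 h2
  exact h1.trans (hc.trans h2)

end

variable {A : Type*} [Fintype A]

theorem getElem?_rowWord (p : RauzyPair A) (ε : Fin 2) {b : A} {k : ℕ} :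
    (p.rowWord ε)[k]? = some b ↔ p.pos ε b = k + 1 := by
  rw [List.getElem?_eq_some_iff]
  simp only [rowWord, List.length_ofFn, List.getElem_ofFn, Equiv.symm_apply_eq, pos,
    add_left_inj, Fin.ext_iff]
  constructor
  · rintro ⟨_, h⟩
    exact h.symm
  · rintro rfl
    exact ⟨(p.row ε b).isLt, rfl⟩

theorem pos_of_rowWord_eq {p : RauzyPair A} {ε : Fin 2} {s t : List A} {u : A}
    (h : p.rowWord ε = s ++ u :: t) : p.pos ε u = s.length + 1 := by
  rw [← getElem?_rowWord, h]
  simp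

theorem HasBlocks.blockWords {p : RauzyPair A} {L : List ℕ} (h : p.HasBlocks L) :
    BlockWords L p.words := by
  obtain ⟨hst, hpos, hn, hb⟩ := h
  obtain ⟨a, ha0, ha1⟩ := hst 0
  obtain ⟨z, hz1, hz0⟩ := hst 1
  simp only [boundary, List.take_length] at hn
  simp only [sub_zero, sub_self] at ha1 hz0
  obtain ⟨W, hW, e0⟩ := exists_eq_cons_append (l := p.rowWord 0) (m := L.sum) (a := a) (z := z)
    (by rw [length_rowWord]; omega) ((p.getElem?_rowWord 0).2 ha0)
    ((p.getElem?_rowWord 0).2 (by omega))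
  obtain ⟨W', hW', e1⟩ := exists_eq_cons_append (l := p.rowWord 1) (m := L.sum) (a := z) (z := a)
    (by rw [length_rowWord]; omega) ((p.getElem?_rowWord 1).2 hz1)
    ((p.getElem?_rowWord 1).2 (by omega))
  refine ⟨a, z, W, W', by rw [words, e0, e1], blocks_of_getElem? hW hW' fun i hi j hj hj' => ?_⟩
  have hle : (L.take (i + 1)).sum ≤ L.sum := (List.take_sublist _ _).sum_le_sum (by simp)
  have hjW : j < W.length := by omega
  rw [List.getElem?_eq_getElem hjW]
  have hp0 : p.pos 0 W[j] = j + 1 + 1 := by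
    rw [← getElem?_rowWord, e0, List.getElem?_cons_succ, List.getElem?_append_left hjW,
      List.getElem?_eq_getElem hjW]
  have hp1 := (hb i hi).2 W[j] (by simp only [boundary]; omega) (by simp only [boundary]; omega)
  simp only [boundary] at hp1
  have : (p.rowWord 1)[(L.take i).sum + (L.take (i + 1)).sum - 1 - j + 1]? = some W[j] := by
    rw [getElem?_rowWord]
    omega
  rwa [e1, List.getElem?_cons_succ, List.getElem?_append_left (by omega)] at this

/-- With `a` removed, `Y` steps back in the cyclic word `z W'` and forward in the cyclic word `z W`:
the rule for the last letter of the first row closes up `z W`, and the first return, which skips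
`a`, closes up `z W'`. Writing `z` at both ends turns cyclic neighbours into consecutive letters, as
`exists_cycles` requires. -/
theorem P_eq_blockCycles [Nonempty A] [DecidableEq A] {p : RauzyPair A} {L : List ℕ}
    (h : BlockWords L p.words) (hL : ∀ s ∈ L, 0 < s) : p.P = (blockCycles 0 L : Multiset ℕ) := by
  obtain ⟨a, z, W, W', hw, hb⟩ := h
  have e0 : p.rowWord 0 = a :: (W ++ [z]) := congrArg Prod.fst hw
  have e1 : p.rowWord 1 = z :: (W' ++ [a]) := congrArg Prod.snd hw
  have ha0 : p.pos 0 a = 1 := pos_of_rowWord_eq (s := []) e0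
  have hz1 : p.pos 1 z = 1 := pos_of_rowWord_eq (s := []) e1
  have ha1 : p.pos 1 a = Fintype.card A := by
    rw [pos_of_rowWord_eq (s := z :: W') e1, ← p.length_rowWord 1, e1]
    simp
  have hz0 : p.pos 0 z = Fintype.card A := by
    rw [pos_of_rowWord_eq (s := a :: W) e0, ← p.length_rowWord 0, e0]
    simp
  have hf : ∀ u x y, Consecutive (z :: (W' ++ [z])) u x → Consecutive (z :: (W ++ [z])) u y →
      p.Y x = y := by
    rintro u x y ⟨s, t, hB⟩ ⟨s', t', hT⟩
    have hF : p.Follows u y := by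
      cases s' with
      | nil =>
        obtain ⟨rfl, hT'⟩ := List.cons.inj hT
        rw [hT'] at e0
        exact .inr ⟨hz0, a, ha1, by rw [ha0, pos_of_rowWord_eq (s := [a]) e0]; rfl⟩
      | cons v s' =>
        obtain ⟨rfl, hT'⟩ := List.cons.inj hT
        replace hT' : W ++ [z] = s' ++ u :: y :: t' := hT'
        rw [hT'] at e0
        refine .inl ?_
        rw [pos_of_rowWord_eq (s := a :: s') e0, pos_of_rowWord_eq (s := a :: (s' ++ [u])) (t := t')
          (by rw [e0]; simp)]
        simp
    apply YGraph.Y_eq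
    rcases List.eq_nil_or_concat t with rfl | ⟨t, v, rfl⟩
    · have hB' : (z :: W') ++ [z] = (s ++ [u]) ++ [x] := by simpa using hB
      obtain ⟨h1, h2⟩ := List.append_inj' hB' rfl
      obtain rfl : z = x := by simpa using h2
      have e1' : p.rowWord 1 = s ++ u :: [a] := by rw [e1, ← List.cons_append, h1]; simp
      refine YGraph.of_first ha0 hz1 ?_ hF
      rw [pos_of_rowWord_eq e1', pos_of_rowWord_eq (s := s ++ [u]) (t := []) (by rw [e1']; simp)]
      simp
    · have hB' : (z :: W') ++ [z] = (s ++ u :: x :: t) ++ [v] := by simpa using hB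
      obtain ⟨h1, -⟩ := List.append_inj' hB' rfl
      have e1' : p.rowWord 1 = s ++ u :: x :: (t ++ [a]) := by
        rw [e1, ← List.cons_append, h1]; simp
      refine YGraph.of_pred ?_ hF
      rw [pos_of_rowWord_eq e1',
        pos_of_rowWord_eq (s := s ++ [u]) (t := t ++ [a]) (by rw [e1']; simp)]
      simp
  obtain ⟨cs, h1, h2, h3⟩ := exists_cycles hf hb hL [z] [z] [] rfl rfl (by
    intro x t y t' hx hy
    exact List.isChain_cons_cons.2 ⟨hf z x y ⟨[], t, by rw [hx]; rfl⟩ ⟨[], t', by rw [hy]; rfl⟩,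
      .singleton _⟩)
  have hn := p.nodup_rowWord 0
  rw [e0, List.nodup_cons] at hn
  have := P_eq_of_cycles h2 (h3.nodup_iff.2 hn.2) fun b => by
    rw [h3.mem_iff, List.nil_append, ← (p.pos_eq_iff 0 le_rfl Fintype.card_pos a).1 ha0]
    have hm := p.mem_rowWord 0 b
    rw [e0, List.mem_cons] at hm
    exact ⟨fun h e => hn.1 (e ▸ h), hm.resolve_left⟩
  rw [this, h1]
  rfl

/-- Matching the first rows letter by letter defines a renaming; the block sizes then force the
second rows to match as well. -/
theorem extClassNonLabeled_eq_of_blockWords {p q : RauzyPair A} {L : List ℕ}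
    (hp : BlockWords L p.words) (hq : BlockWords L q.words) :
    p.extClassNonLabeled = q.extClassNonLabeled := by
  obtain ⟨a, z, W, W', hw, hb⟩ := hp
  obtain ⟨c, y, V, V', hv, hd⟩ := hq
  let σ : Equiv.Perm A := (p.row 0).trans (q.row 0).symm
  have h0 : (p.rename σ).rowWord 0 = q.rowWord 0 := by
    simp only [rowWord, rename]
    congr 1
    ext i
    simp [σ]
  have e0 := h0
  rw [rowWord_rename, show p.rowWord 0 = _ from congrArg Prod.fst hw,
    show q.rowWord 0 = _ from congrArg Prod.fst hv] at e0
  simp only [List.map_cons, List.map_append, List.cons.injEq, List.map_nil] at e0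
  obtain ⟨e1, e2⟩ := e0
  obtain ⟨e2, e3⟩ := List.append_inj' e2 rfl
  have e3 : σ z = y := by simpa using e3
  have e4 := hb.map σ
  rw [e2] at e4
  have e4 := e4.unique hd
  have h1 : (p.rename σ).rowWord 1 = q.rowWord 1 := by
    rw [rowWord_rename, show p.rowWord 1 = _ from congrArg Prod.snd hw,
      show q.rowWord 1 = _ from congrArg Prod.snd hv]
    simp [e1, e3, e4]
  have : p.rename σ = q := words_injective (Prod.ext h0 h1)
  rw [← this, extClassNonLabeled_rename]

theorem isIrreducible_iff_of_eqvGen {p p' : RauzyPair A} (h : Relation.EqvGen ExtStep p p') :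
    p.IsIrreducible ↔ p'.IsIrreducible := by
  induction h with
  | rel p q h => exact iff_of_true h.1 h.2.1
  | refl p => rfl
  | symm p q _ ih => exact ih.symm
  | trans p q r _ _ ih ih' => exact ih.trans ih'

theorem HasBlocks.sum_eq {p : RauzyPair A} {L : List ℕ} (h : p.HasBlocks L) :
    2 + L.sum = Fintype.card A := by
  simpa [boundary] using h.2.2.1

end RauzyPair

/-! ### Conclusion -/

theorem mainTheorem4 {A : Type*} [Fintype A] [DecidableEq A] [Nonempty A]
    (p q : RauzyPair A) (hp : p.IsIrreducible) (hq : q.IsIrreducible)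
    (hType : ∃ x : RauzyPair.TypeLabel, p.HasType x ∧ q.HasType x)
    (hP : p.P = q.P) :
    p.extClassNonLabeled = q.extClassNonLabeled := by
  obtain ⟨x, ⟨p', hp', L, hL, hx⟩, ⟨q', hq', L', hL', hx'⟩⟩ := hType
  have hP' : (RauzyPair.blockCycles 0 L).Perm (RauzyPair.blockCycles 0 L') := by
    rw [← Multiset.coe_eq_coe, ← RauzyPair.P_eq_blockCycles hL.blockWords hL.2.1,
      ← RauzyPair.P_eq_blockCycles hL'.blockWords hL'.2.1,
      ← RauzyPair.P_eq_of_eqvGen hp', ← RauzyPair.P_eq_of_eqvGen hq', hP]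
  have hs : L.sum = L'.sum := by
    have := hL.sum_eq
    have := hL'.sum_eq
    omega
  obtain ⟨v, hv, hc⟩ := (hx.blockConn hx' hL.2.1 hL'.2.1 hs hP').exists_wordConn hL.blockWords
  have hg := RauzyPair.wordGood_words ((RauzyPair.isIrreducible_iff_of_eqvGen hp').1 hp)
  -- `r` lies in the class of `p'` and has the block sizes of `q'`.
  obtain ⟨r, rfl⟩ := (hc.eqvGen_extStep.1.1 hg).exists_pair
  rw [RauzyPair.extClassNonLabeled_eq_of_eqvGen hp', RauzyPair.extClassNonLabeled_eq_of_eqvGen hq',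
    RauzyPair.extClassNonLabeled_eq_of_eqvGen (hc.eqvGen_extStep.2 p' r hg rfl rfl)]
  exact RauzyPair.extClassNonLabeled_eq_of_blockWords hv hL'.blockWords
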